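/- Let $m\ge 3$, $m\ne 4,6$, and $k\ge 0$ be integers. Let $\mathcal H_k$ be the space of complex-valued harmonic polynomials $p(u)$ on $\mathbb R^m$, homogeneous of degree $k$, and let $Z_k(u,v)$ be its reproducing kernel for the inner product $\int_{S^{m-1}}\overline{p}\,q\,dS$ on the unit sphere: $Z_k(\cdot,v)\in\mathcal H_k$ and $\int_{S^{m-1}}\overline{Z_k(u,v)}\,f(u)\,dS(u)=f(v)$ for all $f\in\mathcal H_k$, $v\in\mathbb R^m$. For functions, or distributions in $x\in\mathbb R^m$, with values $f(x,\cdot)\in\mathcal H_k$, write $\langle u,D_x\rangle=\sum_i u_i\partial_{x_i}$, $\langle D_u,D_x\rangle=\sum_i\partial_{u_i}\partial_{x_i}$ and $$\mathcal D_2=\Delta_x-\frac{4}{m+2k-2}\Big(\langle u,D_x\rangle-\frac{\|u\|^2}{m+2k-4}\langle D_u,D_x\rangle\Big)\langle D_u,D_x\rangle,\qquad \mathcal D_4=\mathcal D_2^2-\frac{8}{(m+2k-2)(m+2k-4)}\mathcal D_2\Delta_x .$$ For $x\ne0$ let $\frac{xux}{\|x\|^2}=u-\frac{2\langle x,u\rangle}{\|x\|^2}x$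 (the product is taken in the Clifford algebra with $x^2=-\|x\|^2$). A function $E(x,u,v)$ is called a fundamental solution of $\mathcal D_4$ if $E(x,\cdot,v)\in\mathcal H_k$ for all $x\neq0$ and all $v$, $E(\cdot,u,v)$ is locally integrable on $\mathbb R^m$ for all $u,v$, and for every $v$ $$\mathcal D_4E(x,u,v)=\delta(x)\,Z_k(u,v)$$ in the sense of distributions in $x$, with $\mathcal D_4$ acting in $(x,u)$. **Theorem (Fundamental solutions of $\mathcal D_4$).** There is a nonzero real constant $c_2$ (depending only on $m$ and $k$) such that, for real $c$, the function $$c\,\|x\|^{4-m}\,Z_k\Big(\frac{xux}{\|x\|^2},v\Big)$$ is a fundamental solution of $\mathcal D_4$ if and only if $c=c_2$. -/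

import Mathlib

open MeasureTheory TopologicalSpace
open scoped Distributions LineDeriv

noncomputable section

namespace HigherSpin

/-- The Euclidean space `ℝ^m`. -/
abbrev X (m : ℕ) := EuclideanSpace ℝ (Fin m)

/-- The standard basis vector `e_i` of `ℝ^m`. -/
abbrev e {m : ℕ} (i : Fin m) : X m := EuclideanSpace.single i (1 : ℝ)

/-! ### Homogeneous harmonic polynomials and their reproducing kernel -/

/-- The Laplacian on complex polynomials in `m` variables. -/
def polyLaplacian (m : ℕ) : MvPolynomial (Fin m) ℂ →ₗ[ℂ] MvPolynomial (Fin m) ℂ :=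
  ∑ i, (MvPolynomial.pderiv i).toLinearMap ∘ₗ (MvPolynomial.pderiv i).toLinearMap

/-- The polynomial function on `ℝ^m` of a complex polynomial in `m` variables. -/
def polyFun (m : ℕ) : MvPolynomial (Fin m) ℂ →ₗ[ℂ] (X m → ℂ) :=
  LinearMap.pi fun u => (MvPolynomial.aeval fun i => ((u i : ℝ) : ℂ)).toLinearMap

/-- The space `H_k` of complex-valued harmonic polynomials on `ℝ^m`, homogeneous of degree `k`. -/
def Hk (m k : ℕ) : Submodule ℂ (X m → ℂ) :=
  (MvPolynomial.homogeneousSubmodule (Fin m) ℂ k ⊓ LinearMap.ker (polyLaplacian m)).map (polyFun m)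

/-- The inner product `∫_{S^{m-1}} conj(p) q dS`, for the surface measure of the unit sphere. -/
def sphereInner {m : ℕ} (p q : X m → ℂ) : ℂ :=
  ∫ s : Metric.sphere (0 : X m) 1, starRingEnd ℂ (p s) * q s ∂(volume : Measure (X m)).toSphere

/-- `Z` is a reproducing kernel of `H_k`: every `Z(·, v)` lies in `H_k` and
`f(v) = ∫_{S^{m-1}} conj(Z(u, v)) f(u) dS(u)` for all `f ∈ H_k` and all `v`. -/
def IsReproducingKernel (m k : ℕ) (Z : X m → X m → ℂ) : Prop :=
  (∀ v, (fun u => Z u v) ∈ Hk m k) ∧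
    ∀ f ∈ Hk m k, ∀ v, sphereInner (fun u => Z u v) f = f v

instance (m k : ℕ) : FiniteDimensional ℂ (Hk m k) := by
  have h : FiniteDimensional ℂ (MvPolynomial.homogeneousSubmodule (Fin m) ℂ k) :=
    Module.Finite.iff_fg.2 (MvPolynomial.homogeneousSubmodule_fg (Fin m) ℂ k)
  have h2 : FiniteDimensional ℂ
      (MvPolynomial.homogeneousSubmodule (Fin m) ℂ k ⊓ LinearMap.ker (polyLaplacian m) :
        Submodule ℂ (MvPolynomial (Fin m) ℂ)) :=
    Submodule.finiteDimensional_inf_left _ _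
  unfold Hk
  infer_instance

lemma Hk_continuous {m k : ℕ} {p : X m → ℂ} (hp : p ∈ Hk m k) : Continuous p := by
  obtain ⟨P, -, rfl⟩ := hp
  have : (polyFun m P : X m → ℂ) =
      fun u => MvPolynomial.eval (fun i => ((u i : ℝ) : ℂ)) P := by
    funext u; simp [polyFun, MvPolynomial.aeval_eq_eval]
  rw [this]
  exact (MvPolynomial.continuous_eval P).comp (by fun_prop)

lemma Hk_smul {m k : ℕ} {p : X m → ℂ} (hp : p ∈ Hk m k) (r : ℝ) (u : X m) :
    p (r • u) = (r : ℂ) ^ k * p u := by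
  obtain ⟨P, ⟨hP, -⟩, rfl⟩ := hp
  simp only [polyFun, LinearMap.pi_apply, AlgHom.toLinearMap_apply, MvPolynomial.aeval_eq_eval,
    MvPolynomial.eval_eq, Finset.mul_sum]
  refine Finset.sum_congr rfl fun d hd => ?_
  have hk : ∑ i ∈ d.support, d i = k := by
    simpa [Finsupp.weight_apply, Finsupp.sum] using hP (MvPolynomial.mem_support_iff.1 hd)
  simp only [PiLp.smul_apply, smul_eq_mul, Complex.ofReal_mul, mul_pow, Finset.prod_mul_distrib]
  rw [Finset.prod_pow_eq_pow_sum, hk]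
  ring

lemma sphereInner_integrable {m k : ℕ} {p q : X m → ℂ} (hp : p ∈ Hk m k) (hq : q ∈ Hk m k) :
    Integrable (fun s : Metric.sphere (0 : X m) 1 => starRingEnd ℂ (p s) * q s)
      (volume : Measure (X m)).toSphere := by
  have hc : Continuous (fun s : Metric.sphere (0 : X m) 1 => starRingEnd ℂ (p s) * q s) :=
    (Complex.continuous_conj.comp ((Hk_continuous hp).comp continuous_subtype_val)).mul
      ((Hk_continuous hq).comp continuous_subtype_val)
  exact hc.integrable_of_hasCompactSupport (HasCompactSupport.of_compactSpace _)

lemma sphereInner_self {m : ℕ} (p : X m → ℂ) :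
    sphereInner p p =
      ((∫ s : Metric.sphere (0 : X m) 1, ‖p s‖ ^ 2 ∂(volume : Measure (X m)).toSphere : ℝ) : ℂ) := by
  rw [sphereInner, ← integral_complex_ofReal]
  congr 1
  funext s
  rw [Complex.conj_mul']
  norm_cast

lemma Hk_eq_zero {m k : ℕ} (hm : 0 < m) {p : X m → ℂ} (hp : p ∈ Hk m k)
    (h : sphereInner p p = 0) : p = 0 := by
  have hc : Continuous (fun s : Metric.sphere (0 : X m) 1 => ‖p s‖ ^ 2) :=
    ((Hk_continuous hp).comp continuous_subtype_val).norm.pow 2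
  rw [sphereInner_self, Complex.ofReal_eq_zero] at h
  have h0 := (hc.ae_eq_iff_eq _ continuous_zero).1
    ((integral_eq_zero_iff_of_nonneg (fun s => by positivity)
      (hc.integrable_of_hasCompactSupport (HasCompactSupport.of_compactSpace _))).1 h)
  have hs : ∀ s : Metric.sphere (0 : X m) 1, p s = 0 := fun s => by
    simpa using congrFun h0 s
  funext u
  by_cases hu : u = 0
  · have h1 := hs ⟨e ⟨0, hm⟩, by simp⟩
    have h2 := Hk_smul hp 0 (e ⟨0, hm⟩)
    rw [h1, mul_zero, zero_smul] at h2
    rw [hu, h2, Pi.zero_apply]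
  · have hn : ‖u‖ ≠ 0 := norm_ne_zero_iff.2 hu
    have h1 := hs ⟨‖u‖⁻¹ • u, by simp [norm_smul, hn]⟩
    have h2 := Hk_smul hp ‖u‖ (‖u‖⁻¹ • u)
    rw [h1, mul_zero, smul_smul, mul_inv_cancel₀ hn, one_smul] at h2
    rw [h2, Pi.zero_apply]

/-- The real-linear map `p ↦ (f ↦ sphereInner p f)` from `H_k` to its complex dual. -/
def sphereDual (m k : ℕ) : Hk m k →ₗ[ℝ] (Hk m k →ₗ[ℂ] ℂ) where
  toFun p :=
    { toFun := fun f => sphereInner (p : X m → ℂ) f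
      map_add' := fun f g => by
        simp only [sphereInner]
        rw [← integral_add (sphereInner_integrable p.2 f.2) (sphereInner_integrable p.2 g.2)]
        congr 1
        funext s
        simp [mul_add]
      map_smul' := fun c f => by
        simp only [sphereInner, RingHom.id_apply, smul_eq_mul]
        rw [← integral_const_mul]
        congr 1
        funext s
        simp [mul_left_comm] }
  map_add' p q := by
    ext f
    simp only [sphereInner, LinearMap.coe_mk, AddHom.coe_mk, LinearMap.add_apply]
    rw [← integral_add (sphereInner_integrable p.2 f.2) (sphereInner_integrable q.2 f.2)]
    congr 1
    funext s
    simp [add_mul]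
  map_smul' c p := by
    ext f
    simp only [sphereInner, LinearMap.coe_mk, AddHom.coe_mk, LinearMap.smul_apply,
      RingHom.id_apply, Complex.real_smul]
    rw [← integral_const_mul]
    congr 1
    funext s
    simp [mul_assoc]

lemma sphereDual_injective {m : ℕ} (hm : 0 < m) (k : ℕ) :
    Function.Injective (sphereDual m k) := by
  refine (injective_iff_map_eq_zero _).2 fun p hp => Subtype.ext (Hk_eq_zero hm p.2 ?_)
  exact congrArg (fun L : Hk m k →ₗ[ℂ] ℂ => L p) hp

theorem existsUnique_reproducingKernel {m : ℕ} (hm : 0 < m) (k : ℕ) :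
    ∃! Z, IsReproducingKernel m k Z := by
  have hinj := sphereDual_injective hm k
  have : FiniteDimensional ℝ (Hk m k) := FiniteDimensional.complexToReal _
  have : FiniteDimensional ℝ (Hk m k →ₗ[ℂ] ℂ) := FiniteDimensional.complexToReal _
  have hsurj : Function.Surjective (sphereDual m k) :=
    (LinearMap.injective_iff_surjective_of_finrank_eq_finrank (by
      rw [finrank_real_of_complex, finrank_real_of_complex]
      exact congrArg (2 * ·) (Subspace.dual_finrank_eq (K := ℂ) (V := Hk m k)).symm)).1 hinj
  have key : ∀ v : X m, ∃ z : Hk m k, ∀ f : Hk m k,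
      sphereInner (z : X m → ℂ) f = (f : X m → ℂ) v := fun v => by
    obtain ⟨z, hz⟩ := hsurj (LinearMap.proj v ∘ₗ (Hk m k).subtype)
    exact ⟨z, fun f => congrArg (fun L : Hk m k →ₗ[ℂ] ℂ => L f) hz⟩
  choose z hz using key
  refine ⟨fun u v => (z v : X m → ℂ) u, ⟨fun v => (z v).2, fun f hf v => hz v ⟨f, hf⟩⟩, ?_⟩
  intro Z ⟨hZ, hZ'⟩
  have h : ∀ v, (⟨fun u => Z u v, hZ v⟩ : Hk m k) = z v := fun v =>
    hinj (LinearMap.ext fun f => (hZ' f f.2 v).trans (hz v f).symm)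
  funext u v
  exact congrFun (congrArg Subtype.val (h v)) u

open Classical in
/-- The reproducing kernel `Z_k(u, v)` of `H_k`
(it exists and is unique by `existsUnique_reproducingKernel`; junk value `0` for `m = 0`). -/
def reproducingKernel (m k : ℕ) : X m → X m → ℂ :=
  if h : ∃ Z, IsReproducingKernel m k Z then h.choose else 0

theorem reproducingKernel_spec {m : ℕ} (hm : 0 < m) (k : ℕ) :
    IsReproducingKernel m k (reproducingKernel m k) := by
  have h := (existsUnique_reproducingKernel hm k).exists
  rw [reproducingKernel, dif_pos h]
  exact h.choose_spec

/-! ### The Clifford product `x u x / ‖x‖²` -/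

/-- The quadratic form `x ↦ -‖x‖²`, so that `x² = -‖x‖²` in the Clifford algebra. -/
def cliffordForm (m : ℕ) : QuadraticForm ℝ (X m) :=
  -(LinearMap.BilinMap.toQuadraticMap (innerₗ (X m)))

/-- The vector `x u x / ‖x‖²` of `ℝ^m` (for `x ≠ 0`), with products in the Clifford algebra;
see `ι_sandwich`. -/
def sandwich {m : ℕ} (x u : X m) : X m :=
  u - (2 * inner ℝ x u / ‖x‖ ^ 2) • x

theorem ι_sandwich {m : ℕ} {x : X m} (hx : x ≠ 0) (u : X m) :
    CliffordAlgebra.ι (cliffordForm m) (sandwich x u) =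
      (‖x‖ ^ 2)⁻¹ • (CliffordAlgebra.ι (cliffordForm m) x * CliffordAlgebra.ι (cliffordForm m) u *
        CliffordAlgebra.ι (cliffordForm m) x) := by
  have hn : ‖x‖ ^ 2 ≠ 0 := pow_ne_zero 2 (norm_ne_zero_iff.2 hx)
  have hp : QuadraticMap.polar (cliffordForm m) x u = -(2 * inner ℝ x u) := by
    simp only [QuadraticMap.polar, cliffordForm, neg_apply,
      LinearMap.BilinMap.toQuadraticMap_apply, innerₗ_apply_apply, real_inner_self_eq_norm_sq]
    rw [norm_add_sq_real]
    ring
  have hq : cliffordForm m x = -‖x‖ ^ 2 := by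
    simp [cliffordForm]
  rw [CliffordAlgebra.ι_mul_ι_mul_ι, ← map_smul, sandwich, hp, hq]
  congr 1
  rw [smul_sub, smul_smul, smul_smul]
  have h1 : (‖x‖ ^ 2)⁻¹ * -(2 * inner ℝ x u) = -(2 * inner ℝ x u / ‖x‖ ^ 2) := by ring
  have h2 : (‖x‖ ^ 2)⁻¹ * -‖x‖ ^ 2 = -1 := by field_simp
  rw [h1, h2]
  module

/-! ### The operators `D₂` and `D₄`

An element of `α → X m → ℂ` is a family of functions of `u ∈ ℝ^m`. For `α = ℝ^m` this is a function
`f(x, u)`; for `α` the space of test functions on `ℝ^m` it is a distribution in `x` with values in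
functions of `u`. The operators have constant coefficients in `x`, so that one formula, in terms of
given partial derivatives `∂ i = ∂_{x_i}`, serves for both. -/

section Operators

variable {m : ℕ} {α : Type*} (k : ℕ) (d : Fin m → (α → X m → ℂ) → (α → X m → ℂ))

/-- `Δ_x = ∑ ∂_{x_i}²`. -/
def laplacianX (f : α → X m → ℂ) : α → X m → ℂ := ∑ i, d i (d i f)

/-- `⟨u, D_x⟩ = ∑ u_i ∂_{x_i}`. -/
def uDx (f : α → X m → ℂ) : α → X m → ℂ := fun a u => ∑ i, ((u i : ℝ) : ℂ) * d i f a u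

/-- `⟨D_u, D_x⟩ = ∑ ∂_{u_i} ∂_{x_i}`. -/
def DuDx (f : α → X m → ℂ) : α → X m → ℂ := fun a u => ∑ i, fderiv ℝ (d i f a) u (e i)

/-- The twistor operator `T_{k,2} = ⟨u, D_x⟩ - ‖u‖² ⟨D_u, D_x⟩ / (m + 2k - 4)`. -/
def twistor (f : α → X m → ℂ) : α → X m → ℂ := fun a u =>
  uDx d f a u - ((‖u‖ : ℝ) : ℂ) ^ 2 / ((m : ℂ) + 2 * k - 4) * DuDx d f a u

/-- The higher spin Laplace operator `D₂ = Δ_x - 4 T_{k,2} ⟨D_u, D_x⟩ / (m + 2k - 2)`. -/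
def D₂ (f : α → X m → ℂ) : α → X m → ℂ :=
  laplacianX d f - (4 / ((m : ℂ) + 2 * k - 2)) • twistor k d (DuDx d f)

/-- `D₄ = D₂² - 8 D₂ Δ_x / ((m + 2k - 2) (m + 2k - 4))`. -/
def D₄ (f : α → X m → ℂ) : α → X m → ℂ :=
  D₂ k d (D₂ k d f) -
    (8 / (((m : ℂ) + 2 * k - 2) * ((m : ℂ) + 2 * k - 4))) • D₂ k d (laplacianX d f)

end Operators

/-- The partial derivative `∂_{x_i}` of a function `f(x, u)`. The operator `D₄` on
`C^∞(ℝ^m, H_k)` is `D₄ k partialX`. -/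
def partialX {m : ℕ} (i : Fin m) (f : X m → X m → ℂ) : X m → X m → ℂ :=
  fun x u => fderiv ℝ (fun y => f y u) x (e i)

/-- Real test functions on `ℝ^m`. -/
abbrev Test (m : ℕ) := 𝓓((⊤ : Opens (X m)), ℝ)

/-- The partial derivative `(∂_{x_i} T)(φ) = -T(∂_{x_i} φ)` of a distribution. The operator `D₄` on
`H_k`-valued distributions is `D₄ k distPartialX`. -/
def distPartialX {m : ℕ} (i : Fin m) (T : Test m → X m → ℂ) : Test m → X m → ℂ :=
  fun φ u => -T (∂_{(e i : X m)} φ) u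

/-- The distribution `φ ↦ ∫ φ(x) f(x, ·) dx` of a locally integrable function of `x`. -/
def regularDist {m : ℕ} (f : X m → X m → ℂ) : Test m → X m → ℂ :=
  fun φ u => ∫ x, ((φ x : ℝ) : ℂ) * f x u

/-- `E(x, u, v)` is a fundamental solution of `D₄`: it is an `H_k`-valued function of `x ≠ 0` (as a
polynomial in `u`), it is locally integrable in `x`, and `D₄ E(x, u, v) = δ(x) Z_k(u, v)` in the
sense of distributions in `x`, where `D₄` acts in the variables `x, u`. -/
def IsFundamentalSolution (m k : ℕ) (E : X m → X m → X m → ℂ) : Prop :=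
  (∀ x ≠ 0, ∀ v, (fun u => E x u v) ∈ Hk m k) ∧
  (∀ u v, LocallyIntegrable (fun x => E x u v)) ∧
  ∀ (v : X m) (φ : Test m) (u : X m),
    D₄ k distPartialX (regularDist fun x u => E x u v) φ u =
      ((φ 0 : ℝ) : ℂ) * reproducingKernel m k u v

end HigherSpin

end

/-! Fix `v` and let p = Z_k(·, v), a harmonic polynomial of degree k. Let p_j(x, u) be the
coefficient of t^j in p(u + t x) and F_j = ‖x‖^{4-m} p_j. Since xux/‖x‖² = u - 2⟨x,u⟩x/‖x‖²,
Taylor's formula gives ‖x‖^{4-m} p(xux/‖x‖²) = Σ (-2)^i ‖x‖^{4-m-2i} ⟨x,u⟩^i p_i, which is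
`reflectionDist p 0 k`.

The key is a second form of this sum, on which D₄ is easy to compute. Write U = ⟨u,D_x⟩, A =
⟨D_u,D_x⟩, ρ = ‖u‖², L = Δ_x and T_w = U - ρA/(2w). Up to a nonzero factor the sum is a combination
of products of i twistor operators T_w applied to F_i (`twistorSum`). Both forms are harmonic in u
of degree k, and they agree modulo ‖u‖², where T_w and U coincide. A homogeneous harmonic polynomial
divisible by ‖u‖² is zero, so they are equal (`smul_reflectionDist_eq`).

On the second form D₄ is pure algebra. From [A,U] = L and [A,ρ] = 2U, with L commuting with
everything, A can be moved through a product of twistor operators (`twistorOp_mul_twistorChain`).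
Together with A F_j = (j+1)/(2(j+2)) L F_{j+1} this makes all terms cancel except a multiple of L²
F_0 (`opD₂_opD₂_sum`). As p_0 = p(u), L² F_0 = p Δ²‖x‖^{4-m} is a multiple of δ p.

The analysis is confined to a product rule for ‖x‖^a Q(x,u) with integrable derivative
(`dX_powerDist`) and the flux of x/‖x‖^m (`integral_radialDeriv`). Hence D₄ of the candidate is c ·
`fundamentalConst m k` · δ Z_k. The constant is nonzero for the allowed m, and Z_k is not
identically zero, so exactly one c works. -/

noncomputable section

namespace HigherSpin

/-! ### Distributional calculus of powers of the norm. -/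

section Analysis

open Filter Topology

variable {m : ℕ}

lemma test_lineDeriv_apply (φ : Test m) (v x : X m) : (∂_{v} φ) x = fderiv ℝ φ x v := by
  have h := (φ.contDiff.differentiable (by simp)).differentiableAt (x := x)
  rw [← h.lineDeriv_eq_fderiv]
  exact TestFunction.lineDerivCLM_apply_of_le (𝕜 := ℝ) (by simp)

lemma test_lineDeriv_comm (φ : Test m) (v w : X m) : ∂_{v} (∂_{w} φ) = ∂_{w} (∂_{v} φ) := by
  have hd : Differentiable ℝ (fderiv ℝ φ) :=
    (φ.contDiff.fderiv_right (m := 1) (by norm_cast)).differentiable (by simp)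
  have key : ∀ (a b x : X m), (∂_{a} (∂_{b} φ)) x = fderiv ℝ (fderiv ℝ φ) x a b := by
    intro a b x
    rw [test_lineDeriv_apply]
    have : (⇑(∂_{b} φ : Test m)) = fun y => fderiv ℝ φ y b := funext (test_lineDeriv_apply φ b)
    rw [this, fderiv_clm_apply (hd x) (by fun_prop)]
    simp
  ext x
  rw [key, key]
  have hs : IsSymmSndFDerivAt ℝ φ x :=
    (φ.contDiff.contDiffAt).isSymmSndFDerivAt
      (by rw [minSmoothness_of_isRCLikeNormedField]; norm_cast)
  exact hs v w

lemma locallyIntegrable_norm_rpow_mul {b C : ℝ} (hm : 1 ≤ m) {f : X m → ℝ}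
    (hb : -(m : ℝ) < b) (hf : AEStronglyMeasurable f) (h : ∀ x ≠ 0, |f x| ≤ C * ‖x‖ ^ b) :
    LocallyIntegrable f := by
  have : Nonempty (Fin m) := ⟨⟨0, hm⟩⟩
  refine locallyIntegrable_of_norm_le_rpow (C := C) (α := -b) (by simpa using hm)
    (by simp; linarith) ?_ hf
  filter_upwards [Measure.ae_ne volume (0 : X m)] with x hx
  simpa using h x hx

lemma integrable_test_mul {g : X m → ℝ} (hg : LocallyIntegrable g) (φ : Test m) :
    Integrable fun x => φ x * g x :=
  hg.integrable_smul_left_of_hasCompactSupport φ.continuous φ.hasCompactSupport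

/-- For a ≥ 0 the left side increases in ε, for a ≤ 0 it decreases, so one of its values at ε = 1
and ε = 0 dominates. The sum covers both signs and is a majorant independent of ε. -/
lemma norm_sq_add_rpow_le {a ε : ℝ} (hε : 0 < ε) (hε1 : ε ≤ 1) {x : X m} (hx : x ≠ 0) :
    (‖x‖ ^ 2 + ε) ^ (a / 2) ≤ ‖x‖ ^ a + (‖x‖ ^ 2 + 1) ^ (a / 2) := by
  have hn : 0 < ‖x‖ := norm_pos_iff.2 hx
  have h2 : (‖x‖ ^ 2) ^ (a / 2) = ‖x‖ ^ a := by
    rw [← Real.rpow_natCast, ← Real.rpow_mul hn.le]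
    congr 1
    push_cast
    ring
  rcases le_total 0 a with ha | ha
  · have := Real.rpow_le_rpow (z := a / 2) (by positivity)
      (show ‖x‖ ^ 2 + ε ≤ ‖x‖ ^ 2 + 1 by linarith) (by linarith)
    have h3 : 0 ≤ ‖x‖ ^ a := by positivity
    linarith
  · have := Real.rpow_le_rpow_of_nonpos (z := a / 2) (show 0 < ‖x‖ ^ 2 by positivity)
      (show ‖x‖ ^ 2 ≤ ‖x‖ ^ 2 + ε by linarith) (by linarith)
    have h3 : 0 ≤ (‖x‖ ^ 2 + 1) ^ (a / 2) := by positivity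
    linarith

lemma tendsto_norm_sq_add_rpow (a : ℝ) {x : X m} (hx : x ≠ 0) :
    Tendsto (fun n : ℕ => (‖x‖ ^ 2 + 1 / ((n : ℝ) + 1)) ^ (a / 2)) atTop (𝓝 (‖x‖ ^ a)) := by
  have hn : 0 < ‖x‖ := norm_pos_iff.2 hx
  have h2 : (‖x‖ ^ 2) ^ (a / 2) = ‖x‖ ^ a := by
    rw [← Real.rpow_natCast, ← Real.rpow_mul hn.le]
    congr 1
    push_cast
    ring
  rw [← h2]
  have h := (tendsto_const_nhds (x := ‖x‖ ^ 2)).add (tendsto_one_div_add_atTop_nhds_zero_nat (𝕜 := ℝ))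
  rw [add_zero] at h
  exact h.rpow_const (Or.inl (by positivity))

lemma hasFDerivAt_norm_sq_add_rpow (a : ℝ) {ε : ℝ} (hε : 0 < ε) (x : X m) :
    HasFDerivAt (fun x : X m => (‖x‖ ^ 2 + ε) ^ (a / 2))
      ((a * (‖x‖ ^ 2 + ε) ^ ((a - 2) / 2)) • innerSL ℝ x) x := by
  have h1 : HasFDerivAt (fun x : X m => ‖x‖ ^ 2 + ε) (2 • innerSL ℝ x) x := by
    simpa using ((hasStrictFDerivAt_norm_sq x).hasFDerivAt).add_const ε
  have h2 := h1.rpow_const (p := a / 2) (Or.inl (by positivity))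
  refine h2.congr_fderiv ?_
  ext v
  have : a / 2 - 1 = (a - 2) / 2 := by ring
  simp [this]
  ring

/-- Limit of integrals against the regularised powers of the norm. -/
lemma tendsto_integral_regularised {a b C : ℝ} (hm : 1 ≤ m) {q : X m → ℝ} (hq : Continuous q)
    (hab : -(m : ℝ) < a + b) (hqb : ∀ x ≠ 0, |q x| ≤ C * ‖x‖ ^ b) (φ : Test m) :
    Tendsto (fun n : ℕ => ∫ x, φ x * ((‖x‖ ^ 2 + 1 / ((n : ℝ) + 1)) ^ (a / 2) * q x)) atTop
      (𝓝 (∫ x, φ x * (‖x‖ ^ a * q x))) := by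
  have : Nonempty (Fin m) := ⟨⟨0, hm⟩⟩
  have hc : ∀ ε : ℝ, 0 < ε → Continuous fun x : X m => (‖x‖ ^ 2 + ε) ^ (a / 2) := fun ε hε =>
    continuous_iff_continuousAt.2 fun x => (hasFDerivAt_norm_sq_add_rpow a hε x).continuousAt
  have hmeas : Measurable fun x : X m => ‖x‖ ^ a := by fun_prop
  refine tendsto_integral_of_dominated_convergence
    (fun x => |φ x * (‖x‖ ^ a * q x)| + |φ x * ((‖x‖ ^ 2 + 1) ^ (a / 2) * q x)|) ?_ ?_ ?_ ?_
  · intro n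
    exact (φ.continuous.mul ((hc _ (by positivity)).mul hq)).aestronglyMeasurable
  · refine Integrable.add ?_ ?_
    · refine (integrable_test_mul (locallyIntegrable_norm_rpow_mul (b := a + b) (C := C) hm hab
        (hmeas.aestronglyMeasurable.mul hq.aestronglyMeasurable) fun x hx => ?_) φ).abs
      have hn : 0 < ‖x‖ := norm_pos_iff.2 hx
      rw [Pi.mul_apply, abs_mul, abs_of_nonneg (by positivity), Real.rpow_add hn]
      calc _ ≤ ‖x‖ ^ a * (C * ‖x‖ ^ b) := by gcongr; exact hqb x hx
        _ = _ := by ring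
    · exact (integrable_test_mul ((hc 1 one_pos).mul hq).locallyIntegrable φ).abs
  · intro n
    filter_upwards [Measure.ae_ne volume (0 : X m)] with x hx
    have hle : (1 : ℝ) / ((n : ℝ) + 1) ≤ 1 := by
      rw [div_le_one (by positivity)]
      linarith [(n.cast_nonneg : (0 : ℝ) ≤ n)]
    have h1 := norm_sq_add_rpow_le (a := a) (ε := 1 / ((n : ℝ) + 1)) (by positivity) hle hx
    rw [Real.norm_eq_abs]
    simp only [abs_mul]
    rw [abs_of_nonneg (a := (‖x‖ ^ 2 + 1 / ((n : ℝ) + 1)) ^ (a / 2)) (by positivity),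
      abs_of_nonneg (a := ‖x‖ ^ a) (by positivity),
      abs_of_nonneg (a := (‖x‖ ^ 2 + 1) ^ (a / 2)) (by positivity)]
    calc _ ≤ |φ x| * ((‖x‖ ^ a + (‖x‖ ^ 2 + 1) ^ (a / 2)) * |q x|) := by gcongr
      _ = _ := by ring
  · filter_upwards [Measure.ae_ne volume (0 : X m)] with x hx
    exact ((tendsto_norm_sq_add_rpow a hx).mul_const _).const_mul _

/-- Integration by parts for `‖x‖ ^ a * q x`, whose derivative is locally integrable at `0`. -/
lemma integral_lineDeriv_norm_rpow_mul {a d C : ℝ} (hm : 1 ≤ m) {q : X m → ℝ} (hq : ContDiff ℝ 1 q)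
    (i : Fin m) (had : -(m : ℝ) < a + d - 1) (hqb : ∀ x ≠ 0, |q x| ≤ C * ‖x‖ ^ d)
    (hqd : ∀ x ≠ 0, |fderiv ℝ q x (e i)| ≤ C * ‖x‖ ^ (d - 1)) (φ : Test m) :
    -∫ x, (∂_{(e i : X m)} φ) x * (‖x‖ ^ a * q x) =
      (a * ∫ x, φ x * (‖x‖ ^ (a - 2) * (x i * q x))) +
        ∫ x, φ x * (‖x‖ ^ a * fderiv ℝ q x (e i)) := by
  have hqc := hq.continuous
  have hqd' := hq.differentiable one_ne_zero
  have hqdc : Continuous fun x => fderiv ℝ q x (e i) :=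
    (hq.continuous_fderiv one_ne_zero).clm_apply continuous_const
  have hxi : Continuous fun x : X m => x i := by fun_prop
  have hC : ∀ x : X m, x ≠ 0 → |x i * q x| ≤ C * ‖x‖ ^ (d + 1) := by
    intro x hx
    have hn : 0 < ‖x‖ := norm_pos_iff.2 hx
    rw [abs_mul, Real.rpow_add hn, Real.rpow_one]
    calc _ ≤ ‖x‖ * (C * ‖x‖ ^ d) := by
          gcongr
          · exact PiLp.norm_apply_le x i
          · exact hqb x hx
      _ = _ := by ring
  have t1 := (tendsto_integral_regularised (a := a) (b := d) hm hqc (by linarith) hqb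
    (∂_{(e i : X m)} φ)).neg
  have t2 := (tendsto_integral_regularised (a := a - 2) (b := d + 1) (q := fun x => x i * q x) hm
    (hxi.mul hqc) (by linarith) hC φ).const_mul a
  have t3 := tendsto_integral_regularised (a := a) (b := d - 1) hm hqdc (by linarith) hqd φ
  -- Replacing ‖x‖² by ‖x‖² + ε makes the power differentiable at 0, so ordinary integration by
  -- parts applies for each ε = 1/(n+1). The two sides then have equal limits.
  refine tendsto_nhds_unique t1 ((t2.add t3).congr fun n => ?_)
  set ε : ℝ := 1 / ((n : ℝ) + 1)
  have hε : 0 < ε := by positivity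
  have hc : ∀ a : ℝ, Continuous fun x : X m => (‖x‖ ^ 2 + ε) ^ (a / 2) := fun a =>
    continuous_iff_continuousAt.2 fun x => (hasFDerivAt_norm_sq_add_rpow a hε x).continuousAt
  have hg : ∀ x, HasFDerivAt (fun x : X m => (‖x‖ ^ 2 + ε) ^ (a / 2) * q x) _ x := fun x =>
    (hasFDerivAt_norm_sq_add_rpow a hε x).mul (hqd' x).hasFDerivAt
  have hgd : ∀ x, fderiv ℝ (fun x : X m => (‖x‖ ^ 2 + ε) ^ (a / 2) * q x) x (e i) =
      a * ((‖x‖ ^ 2 + ε) ^ ((a - 2) / 2) * (x i * q x)) +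
        (‖x‖ ^ 2 + ε) ^ (a / 2) * fderiv ℝ q x (e i) := by
    intro x
    rw [(hg x).fderiv]
    have : inner ℝ x (e i) = x i := by simp [EuclideanSpace.inner_single_right]
    simp [this]
    ring
  have i2 : Integrable fun x => φ x * ((‖x‖ ^ 2 + ε) ^ ((a - 2) / 2) * (x i * q x)) :=
    integrable_test_mul ((hc _).mul (hxi.mul hqc)).locallyIntegrable φ
  have i3 : Integrable fun x => φ x * ((‖x‖ ^ 2 + ε) ^ (a / 2) * fderiv ℝ q x (e i)) :=
    integrable_test_mul ((hc _).mul hqdc).locallyIntegrable φ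
  have hφ : ∀ x, fderiv ℝ φ x (e i) = (∂_{(e i : X m)} φ) x := fun x =>
    (test_lineDeriv_apply φ _ x).symm
  have key := integral_mul_fderiv_eq_neg_fderiv_mul_of_integrable (μ := volume) (v := e i)
    (f := (φ : X m → ℝ)) (g := fun x : X m => (‖x‖ ^ 2 + ε) ^ (a / 2) * q x)
    (by simp only [hφ]; exact integrable_test_mul ((hc _).mul hqc).locallyIntegrable _)
    (by
      simp only [hgd]
      refine ((i2.const_mul a).add i3).congr (.of_forall fun x => ?_)
      simp only [Pi.add_apply]
      ring)
    (integrable_test_mul ((hc _).mul hqc).locallyIntegrable φ)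
    (fun x _ => (φ.contDiff.differentiable (by simp)).differentiableAt)
    (fun x _ => (hg x).differentiableAt)
  simp only [hφ] at key
  rw [← key, ← integral_const_mul, ← integral_add (i2.const_mul a) i3]
  refine integral_congr_ae (.of_forall fun x => ?_)
  simp only [hgd]
  ring

/-- The flux of `x / ‖x‖ ^ m` through spheres around `0`. -/
lemma integral_radialDeriv (hm : 2 ≤ m) (φ : Test m) :
    ∑ i, ∫ x, (∂_{(e i : X m)} φ) x * (‖x‖ ^ (-(m : ℝ)) * x i) =
      -((volume : Measure (X m)).toSphere.real Set.univ * φ 0) := by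
  have hne : Nonempty (Fin m) := ⟨⟨0, by omega⟩⟩
  have hmeas : Measurable fun x : X m => ‖x‖ ^ (-(m : ℝ)) := by fun_prop
  have hint : ∀ i : Fin m, Integrable fun x => (∂_{(e i : X m)} φ) x * (‖x‖ ^ (-(m : ℝ)) * x i) :=
    fun i => by
      refine integrable_test_mul (locallyIntegrable_norm_rpow_mul (b := -(m : ℝ) + 1) (C := 1)
        (by omega) (by linarith) (hmeas.aestronglyMeasurable.mul (by fun_prop)) fun x hx => ?_) _
      have hn : 0 < ‖x‖ := norm_pos_iff.2 hx
      rw [Pi.mul_apply, abs_mul, abs_of_nonneg (by positivity), Real.rpow_add hn, Real.rpow_one,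
        one_mul]
      gcongr
      exact PiLp.norm_apply_le x i
  set G : X m → ℝ := fun x => ‖x‖ ^ (-(m : ℝ)) * fderiv ℝ φ x x with hG
  -- The sum over i collapses to the radial derivative ‖x‖^{-m} Dφ(x)(x), to be integrated in polar
  -- coordinates.
  have hsum : ∀ x, ∑ i, (∂_{(e i : X m)} φ) x * (‖x‖ ^ (-(m : ℝ)) * x i) = G x := by
    intro x
    have hx : x = ∑ i, x i • (e i : X m) := by
      ext j
      simp [Finset.sum_apply, Pi.single_apply]
    simp only [test_lineDeriv_apply, hG]
    have hL : fderiv ℝ φ x x = ∑ i, x i * fderiv ℝ φ x (e i) := by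
      conv_lhs => rw [hx, map_sum, ← hx]
      simp
    rw [hL, Finset.mul_sum]
    refine Finset.sum_congr rfl fun i _ => ?_
    ring
  have hGi : Integrable G := by
    have := integrable_finsetSum (Finset.univ : Finset (Fin m)) fun i _ => hint i
    simpa only [hsum] using this
  rw [← integral_finsetSum _ fun i _ => hint i]
  simp only [hsum]
  have hdim : Module.finrank ℝ (X m) = m := by simp
  have hmp := (volume : Measure (X m)).measurePreserving_homeomorphUnitSphereProd
  have hemb := (homeomorphUnitSphereProd (X m)).measurableEmbedding
  set G' : Metric.sphere (0 : X m) 1 × Set.Ioi (0 : ℝ) → ℝ := fun p => G ((p.2 : ℝ) • (p.1 : X m))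
  have hcomp : ∀ x : ({0}ᶜ : Set (X m)), G' (homeomorphUnitSphereProd (X m) x) = G x := by
    intro x
    have : ‖(x : X m)‖ ≠ 0 := norm_ne_zero_iff.2 x.2
    simp only [G', homeomorphUnitSphereProd_apply_snd_coe, homeomorphUnitSphereProd_apply_fst_coe]
    rw [smul_smul, mul_inv_cancel₀ this, one_smul]
  have e1 : ∫ x, G x = ∫ p, G' p ∂((volume : Measure (X m)).toSphere.prod
      (Measure.volumeIoiPow (Module.finrank ℝ (X m) - 1))) := by
    rw [← hmp.integral_comp hemb]
    simp only [hcomp]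
    rw [integral_subtype_comap (measurableSet_singleton _).compl fun x => G x,
      restrict_compl_singleton]
  have hG'i : Integrable G' ((volume : Measure (X m)).toSphere.prod
      (Measure.volumeIoiPow (Module.finrank ℝ (X m) - 1))) := by
    rw [← hmp.integrable_comp_emb hemb]
    have : G' ∘ homeomorphUnitSphereProd (X m) = G ∘ Subtype.val := funext hcomp
    rw [this, ← integrableOn_iff_comap_subtypeVal (measurableSet_singleton _).compl]
    exact hGi.integrableOn
  rw [e1, integral_prod _ hG'i]
  -- On each ray the integrand is the derivative of t ↦ φ(t s), so its integral over (0, ∞) is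
  -- -φ(0).
  have inner_eq : ∀ s : Metric.sphere (0 : X m) 1,
      ∫ r, G' (s, r) ∂(Measure.volumeIoiPow (Module.finrank ℝ (X m) - 1)) = -φ 0 := by
    intro s
    have hs : ‖(s : X m)‖ = 1 := by simp
    simp only [Measure.volumeIoiPow, ENNReal.ofReal]
    rw [integral_withDensity_eq_integral_smul
      ((measurable_subtype_coe.pow_const _).real_toNNReal),
      integral_subtype_comap measurableSet_Ioi fun a : ℝ =>
        Real.toNNReal (a ^ (Module.finrank ℝ (X m) - 1)) • G (a • (s : X m))]
    have hder : ∀ t : ℝ, HasDerivAt (fun t : ℝ => φ (t • (s : X m)))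
        (fderiv ℝ φ (t • (s : X m)) s) t := fun t => by
      have h1 := ((φ.contDiff.differentiable (by simp)).differentiableAt
        (x := t • (s : X m))).hasFDerivAt
      have h2 : HasDerivAt (fun t : ℝ => t • (s : X m)) ((1 : ℝ) • (s : X m)) t :=
        (hasDerivAt_id t).smul_const _
      have h3 := h1.comp_hasDerivAt t h2
      rw [one_smul] at h3
      exact h3
    have hcont : Continuous fun t : ℝ => fderiv ℝ φ (t • (s : X m)) s :=
      ((φ.contDiff.continuous_fderiv (by simp)).comp (by fun_prop)).clm_apply continuous_const
    have hproper : IsClosedEmbedding fun t : ℝ => t • (s : X m) := by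
      refine Isometry.isClosedEmbedding (Isometry.of_dist_eq fun a b => ?_)
      rw [dist_eq_norm, ← sub_smul, norm_smul, hs, mul_one, dist_eq_norm]
    have hcs : HasCompactSupport fun t : ℝ => φ (t • (s : X m)) :=
      φ.hasCompactSupport.comp_isClosedEmbedding hproper
    have hcs' : HasCompactSupport fun t : ℝ => fderiv ℝ φ (t • (s : X m)) s := by
      have : HasCompactSupport fun x => fderiv ℝ φ x (s : X m) :=
        (φ.hasCompactSupport.fderiv ℝ).comp_left (g := fun L : X m →L[ℝ] ℝ => L s) (by simp)
      exact this.comp_isClosedEmbedding hproper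
    have := integral_Ioi_of_hasDerivAt_of_tendsto (a := 0) (m := 0)
      ((hder 0).continuousAt.continuousWithinAt) (fun t _ => hder t)
      (hcont.integrable_of_hasCompactSupport hcs').integrableOn
      (hcs.is_zero_at_infty.mono_left atTop_le_cocompact)
    rw [zero_smul, zero_sub] at this
    rw [← this]
    refine setIntegral_congr_fun measurableSet_Ioi fun t (ht : 0 < t) => ?_
    simp only [hG]
    rw [NNReal.smul_def, Real.coe_toNNReal _ (by positivity), norm_smul, hs, mul_one, hdim,
      Real.norm_of_nonneg ht.le, smul_eq_mul, map_smul, smul_eq_mul, ← Real.rpow_natCast]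
    -- The polar density t^{m-1} exactly cancels the singular weight.
    have : t ^ ((m - 1 : ℕ) : ℝ) * (t ^ (-(m : ℝ)) * t) = 1 := by
      rw [← Real.rpow_add_one ht.ne', ← Real.rpow_add ht, Nat.cast_sub (by omega)]
      simp
    rw [← mul_assoc, ← mul_assoc, mul_assoc (_ ^ _), this, one_mul]
  simp only [inner_eq]
  simp

end Analysis

section TwistorAlgebra

/-! ### The algebra generated by `⟨u, D_x⟩`, `⟨D_u, D_x⟩`, `‖u‖²` and `Δ_x` -/

variable {B : Type*} [Ring B] [Algebra ℂ B]

/-- The twistor operator `U - ρ A / (2 w)`. -/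
def twistorOp (A U ρ : B) (w : ℂ) : B := U - (1 / (2 * w)) • (ρ * A)

/-- The product of the `j` twistor operators with parameters `w + j, …, w + 1`. -/
def twistorChain (A U ρ : B) (w : ℂ) : ℕ → B
  | 0 => 1
  | j + 1 => twistorOp A U ρ (w + j + 1) * twistorChain A U ρ w j

variable {A U ρ L : B}

/-- Moving A past ρ in the correction term produces -(1/w) U A. This scales U A by (w-1)/w, and ρAA
keeps the coefficient that T_{w-1} requires after the same scaling. -/
lemma mul_twistorOp (hAU : A * U = U * A + L) (hAρ : A * ρ = ρ * A + 2 * U) {w : ℂ}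
    (hw : w ≠ 0) (hw1 : w - 1 ≠ 0) :
    A * twistorOp A U ρ w = ((w - 1) / w) • (twistorOp A U ρ (w - 1) * A) + L := by
  have h1 : A * (ρ * A) = ρ * A * A + (2 : ℂ) • (U * A) := by
    rw [← mul_assoc, hAρ, add_mul, two_smul, two_mul, add_mul]
  rw [twistorOp, twistorOp, mul_sub, sub_mul, mul_smul_comm, smul_mul_assoc, h1, hAU]
  have h2 : (w - 1) / w * (1 / (2 * (w - 1))) = 1 / (2 * w) := by field_simp
  have h3 : (w - 1) / w = 1 - 1 / w := by field_simp
  have h4 : 1 / (2 * w) * 2 = 1 / w := by field_simp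
  rw [smul_add, smul_sub, smul_smul, smul_smul, h2, h4, h3, sub_smul, one_smul]
  abel

lemma commute_twistorOp (hLA : Commute L A) (hLU : Commute L U) (hLρ : Commute L ρ) (w : ℂ) :
    Commute L (twistorOp A U ρ w) :=
  hLU.sub_right ((hLρ.mul_right hLA).smul_right _)

lemma commute_twistorChain (hLA : Commute L A) (hLU : Commute L U) (hLρ : Commute L ρ) (w : ℂ)
    (j : ℕ) : Commute L (twistorChain A U ρ w j) := by
  induction j with
  | zero => exact Commute.one_right _
  | succ j ih => exact (commute_twistorOp hLA hLU hLρ _).mul_right ih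

/-- A passes through the chain one factor at a time by `mul_twistorOp`. The factors (w+i-1)/(w+i)
telescope to w/(w+j), and the copies of L add up to ((w+1) + ⋯ + (w+j))/(w+j). -/
lemma twistorOp_mul_twistorChain (hAU : A * U = U * A + L) (hAρ : A * ρ = ρ * A + 2 * U)
    (hLA : Commute L A) (hLU : Commute L U) (hLρ : Commute L ρ) {w : ℂ}
    (hw : ∀ i : ℕ, w + i ≠ 0) (j : ℕ) :
    twistorOp A U ρ (w + j) * A * twistorChain A U ρ w j =
      (w / (w + j)) • (twistorChain A U ρ (w - 1) (j + 1) * A) +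
        (j * (2 * w + j + 1) / (2 * (w + j))) • (L * twistorChain A U ρ w j) := by
  induction j with
  | zero =>
    have h0 : w ≠ 0 := by simpa using hw 0
    simp [twistorChain, h0]
  | succ j ih =>
    have hj := hw j
    have hj1 : w + j + 1 ≠ 0 := by simpa [add_assoc] using hw (j + 1)
    have e1 : w + ((j + 1 : ℕ) : ℂ) = w + j + 1 := by push_cast; ring
    have e2 : w - 1 + ((j + 1 : ℕ) : ℂ) + 1 = w + j + 1 := by push_cast; ring
    have hc := commute_twistorOp hLA hLU hLρ (w + j + 1)
    have h1 : A * twistorChain A U ρ w (j + 1) =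
        (w / (w + j + 1)) • (twistorChain A U ρ (w - 1) (j + 1) * A) +
        ((j + 1) * (2 * w + j + 2) / (2 * (w + j + 1))) • (L * twistorChain A U ρ w j) := by
      have h2 := mul_twistorOp hAU hAρ (w := w + j + 1) hj1 (by simpa using hj)
      rw [add_sub_cancel_right] at h2
      rw [twistorChain, ← mul_assoc, h2, add_mul, smul_mul_assoc, ih, smul_add, smul_smul,
        smul_smul, add_assoc]
      congr 1
      · congr 1
        field_simp
      · nth_rewrite 2 [← one_smul ℂ (L * _)]
        rw [← add_smul]
        congr 1
        field_simp
        ring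
    rw [mul_assoc, e1, h1, mul_add, mul_smul_comm, mul_smul_comm, ← mul_assoc, ← mul_assoc,
      ← hc.eq, mul_assoc L]
    rw [twistorChain.eq_2 A U ρ (w - 1) (j + 1), e2, twistorChain.eq_2 A U ρ w j]
    congr 2
    push_cast
    ring

end TwistorAlgebra

/-! ### Algebraic action of D₄ on sums of twistor chains. -/

section ChainSum

variable {V : Type*} [AddCommGroup V] [Module ℂ V]

/-- Regroups the output of a bidiagonal operator by basis vector. -/
lemma sum_smul_add_shift (k : ℕ) (a b : ℕ → ℂ) (v : ℕ → V) (hv : v (k + 1) = 0) :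
    ∑ j ∈ Finset.range (k + 1), (a j • v j + b j • v (j + 1)) =
      a 0 • v 0 + ∑ j ∈ Finset.range k, (a (j + 1) + b j) • v (j + 1) := by
  rw [Finset.sum_add_distrib, Finset.sum_range_succ', Finset.sum_range_succ (fun j => b j • _), hv,
    smul_zero, add_zero, add_comm (Finset.sum _ _), add_assoc, ← Finset.sum_add_distrib]
  simp only [add_smul]

variable (A U ρ L : Module.End ℂ V)

/-- The operator `D₂` written with the generators. -/
def opD₂ (y : ℂ) : Module.End ℂ V := L - (2 / (y + 1)) • (twistorOp A U ρ y * A)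

variable {A U ρ L}

/-- The terms of the expansion of the fundamental solution. -/
lemma twistorOp_chain_apply (hAU : A * U = U * A + L) (hAρ : A * ρ = ρ * A + 2 * U)
    (hLA : Commute L A) (hLU : Commute L U) (hLρ : Commute L ρ) {σ : ℂ}
    (hσ : ∀ i : ℕ, σ + i ≠ 0) {k j : ℕ} (hjk : j ≤ k) {F : ℕ → V}
    (hF : ∀ j, A (F j) = (((j : ℂ) + 1) / (2 * (j + 2))) • L (F (j + 1))) :
    (twistorOp A U ρ (σ + k) * A) (twistorChain A U ρ (σ + k - j) j (F j)) =
      L (((σ + k - j) / (σ + k) * ((j + 1) / (2 * (j + 2)))) •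
          twistorChain A U ρ (σ + k - (j + 1 : ℕ)) (j + 1) (F (j + 1)) +
        (j * (2 * (σ + k) - j + 1) / (2 * (σ + k))) •
          twistorChain A U ρ (σ + k - j) j (F j)) := by
  have hw : ∀ i : ℕ, σ + k - j + i ≠ 0 := fun i => by
    have := hσ (k - j + i)
    rw [Nat.cast_add, Nat.cast_sub hjk] at this
    convert this using 1
    ring
  have h := twistorOp_mul_twistorChain hAU hAρ hLA hLU hLρ hw j
  have e1 : σ + k - j + j = σ + k := by ring
  have e2 : 2 * (σ + k - j) + j + 1 = 2 * (σ + k) - j + 1 := by ring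
  have e3 : σ + k - j - 1 = σ + k - (j + 1 : ℕ) := by push_cast; ring
  rw [e1, e2, e3] at h
  have h' := LinearMap.congr_fun h (F j)
  have hc := LinearMap.congr_fun
    (commute_twistorChain hLA hLU hLρ (σ + k - (j + 1 : ℕ)) (j + 1)).eq (F (j + 1))
  simp only [Module.End.mul_apply, LinearMap.add_apply, LinearMap.smul_apply] at h' hc ⊢
  rw [h', hF, map_smul, ← hc, map_add, map_smul, map_smul, smul_smul]

/-- Application of `D₄` to the expansion of the fundamental solution. -/
theorem opD₂_opD₂_sum (hAU : A * U = U * A + L) (hAρ : A * ρ = ρ * A + 2 * U)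
    (hLA : Commute L A) (hLU : Commute L U) (hLρ : Commute L ρ) {σ : ℂ}
    (hσ : ∀ i : ℕ, σ + i ≠ 0) (k : ℕ) {F : ℕ → V} (hFk : F (k + 1) = 0)
    (hF : ∀ j, A (F j) = (((j : ℂ) + 1) / (2 * (j + 2))) • L (F (j + 1)))
    {c : ℕ → ℂ} (hc : ∀ n, c (n + 1) = c n * (σ - 1 + n)) :
    opD₂ A U ρ L (σ + k) ((opD₂ A U ρ L (σ + k) - (2 / ((σ + k) * (σ + k + 1))) • L)
        (∑ j ∈ Finset.range (k + 1), c (k - j) • twistorChain A U ρ (σ + k - j) j (F j))) =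
      (c k * (1 - 2 / ((σ + k) * (σ + k + 1)))) • L (L (F 0)) := by
  set y := σ + k with hy
  have hy0 : y ≠ 0 := hσ k
  have hy1 : y + 1 ≠ 0 := by simpa [hy, add_assoc] using hσ (k + 1)
  set v : ℕ → V := fun j => twistorChain A U ρ (y - j) j (F j) with hv
  have hvk : v (k + 1) = 0 := by simp [hv, hFk]
  have hL2 : ∀ x, opD₂ A U ρ L y (L x) = L (opD₂ A U ρ L y x) := by
    have : Commute (opD₂ A U ρ L y) L :=
      ((Commute.refl L).sub_right
        (((commute_twistorOp hLA hLU hLρ y).mul_right hLA).smul_right _)).symm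
    exact fun x => LinearMap.congr_fun this.eq x
  -- D₂ is bidiagonal on the chain terms, up to a factor L. The diagonal entry equals
  -- (y-j)(y-j+1)/(y(y+1)), which makes the later cancellations possible.
  have hD : ∀ j ≤ k, opD₂ A U ρ L y (v j) =
      L ((1 - j * (2 * y - j + 1) / (y * (y + 1))) • v j +
        (-((y - j) * (j + 1) / (y * (y + 1) * (j + 2)))) • v (j + 1)) := by
    intro j hj
    have := twistorOp_chain_apply hAU hAρ hLA hLU hLρ hσ hj hF
    rw [← hy] at this
    have hj2 : (j : ℂ) + 2 ≠ 0 := by exact_mod_cast (by omega : j + 2 ≠ 0)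
    rw [opD₂, LinearMap.sub_apply, LinearMap.smul_apply, this, ← map_smul L, ← map_sub L, smul_add,
      smul_smul, smul_smul]
    congr 1
    rw [sub_add_eq_sub_sub, sub_right_comm, sub_smul, one_smul, sub_eq_add_neg _ (_ • v (j + 1)),
      ← neg_smul]
    congr 3 <;> field_simp
  -- The coefficients left after the first factor D₂ - 2L/(y(y+1)); the recurrence of `c` merges the
  -- two contributions to each term into this product.
  set f : ℕ → ℂ := fun j => c (k - j) * (y - j - 1) * (y + 2) / ((j + 1) * (y * (y + 1))) with hf
  have hck : ∀ j < k, c (k - j) = c (k - (j + 1)) * (y - j - 2) := by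
    intro j hj
    have h := hc (k - (j + 1))
    rw [show k - (j + 1) + 1 = k - j by omega, Nat.cast_sub (by omega)] at h
    rw [h, hy]
    push_cast
    ring
  have step1 : (opD₂ A U ρ L y - (2 / (y * (y + 1))) • L)
      (∑ j ∈ Finset.range (k + 1), c (k - j) • v j) =
      L (∑ j ∈ Finset.range (k + 1), f j • v j) := by
    have h1 : ∀ j ∈ Finset.range (k + 1), (opD₂ A U ρ L y - (2 / (y * (y + 1))) • L)
        (c (k - j) • v j) = L ((c (k - j) * (1 - (2 + j * (2 * y - j + 1)) / (y * (y + 1)))) • v j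
          + (-(c (k - j) * ((y - j) * (j + 1) / (y * (y + 1) * (j + 2))))) • v (j + 1)) := by
      intro j hj
      rw [map_smul, LinearMap.sub_apply, hD j (by simpa [Nat.lt_succ_iff] using hj),
        LinearMap.smul_apply, ← map_smul L, ← map_sub L, ← map_smul L]
      congr 1
      module
    rw [map_sum, Finset.sum_congr rfl h1, ← map_sum]
    congr 1
    rw [sum_smul_add_shift k _ _ v hvk, Finset.sum_range_succ', add_comm]
    congr 1
    · refine Finset.sum_congr rfl fun j hj => ?_
      congr 1
      have hj' : j < k := Finset.mem_range.1 hj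
      have hj1 : (j : ℂ) + 1 ≠ 0 := by exact_mod_cast (by omega : j + 1 ≠ 0)
      have hj2 : (j : ℂ) + 2 ≠ 0 := by exact_mod_cast (by omega : j + 2 ≠ 0)
      have hj3 : (j : ℂ) + 1 + 1 ≠ 0 := by exact_mod_cast (by omega : j + 1 + 1 ≠ 0)
      simp only [hf, hck j hj']
      push_cast
      field_simp
      ring
    · simp only [hf]
      congr 1
      push_cast
      field_simp
      ring
  rw [step1, hL2, map_sum]
  have h2 : ∀ j ∈ Finset.range (k + 1), opD₂ A U ρ L y (f j • v j) =
      L ((f j * (1 - j * (2 * y - j + 1) / (y * (y + 1)))) • v j +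
        (-(f j * ((y - j) * (j + 1) / (y * (y + 1) * (j + 2))))) • v (j + 1)) := by
    intro j hj
    rw [map_smul, hD j (by simpa [Nat.lt_succ_iff] using hj), ← map_smul]
    congr 1
    module
  -- After the second D₂ the diagonal contribution of index j+1 cancels the off-diagonal one of
  -- index j, so only v 0 survives. Its coefficient f 0 is c k (y-1)(y+2)/(y(y+1)) = c k (1 -
  -- 2/(y(y+1))).
  rw [Finset.sum_congr rfl h2, ← map_sum, sum_smul_add_shift k _ _ v hvk, Finset.sum_eq_zero,
    add_zero]
  · have : v 0 = F 0 := by simp [hv, twistorChain]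
    rw [this, map_smul, map_smul]
    congr 1
    simp only [hf]
    push_cast
    field_simp
    rw [Nat.sub_zero]
    ring
  · intro j hj
    have hj' : j < k := Finset.mem_range.1 hj
    have hj1 : (j : ℂ) + 1 ≠ 0 := by exact_mod_cast (by omega : j + 1 ≠ 0)
    have hj2 : (j : ℂ) + 2 ≠ 0 := by exact_mod_cast (by omega : j + 2 ≠ 0)
    have hj3 : (j : ℂ) + 1 + 1 ≠ 0 := by exact_mod_cast (by omega : j + 1 + 1 ≠ 0)
    convert zero_smul ℂ _
    simp only [hf, hck j hj']
    push_cast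
    field_simp
    ring

end ChainSum

/-! ### Differentiating polynomial functions. -/

section PolynomialFunctions

variable {m : ℕ} {𝕜 : Type*} [RCLike 𝕜]

/-- Stated over `RCLike` because it serves real monomials in x as well as complex polynomials in u.
-/
lemma contDiff_aeval (P : MvPolynomial (Fin m) 𝕜) :
    ContDiff ℝ 1 fun u : X m => MvPolynomial.aeval (fun i => ((u i : ℝ) : 𝕜)) P := by
  induction P using MvPolynomial.induction_on with
  | C a => simpa using contDiff_const
  | add p q hp hq => simpa using hp.add hq
  | mul_X p i hp =>
    simp only [map_mul, MvPolynomial.aeval_X]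
    exact hp.mul ((RCLike.ofRealCLM : ℝ →L[ℝ] 𝕜).comp
      (EuclideanSpace.proj i : X m →L[ℝ] ℝ)).contDiff

lemma fderiv_aeval (P : MvPolynomial (Fin m) 𝕜) (u : X m) (i : Fin m) :
    fderiv ℝ (fun u : X m => MvPolynomial.aeval (fun i => ((u i : ℝ) : 𝕜)) P) u (e i) =
      MvPolynomial.aeval (fun i => ((u i : ℝ) : 𝕜)) (MvPolynomial.pderiv i P) := by
  have hd : ∀ P : MvPolynomial (Fin m) 𝕜, DifferentiableAt ℝ
      (fun u : X m => MvPolynomial.aeval (fun i => ((u i : ℝ) : 𝕜)) P) u := fun P =>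
    (contDiff_aeval P).differentiable one_ne_zero u
  induction P using MvPolynomial.induction_on with
  | C a => simp
  | add p q hp hq =>
    simp only [map_add]
    rw [fderiv_fun_add (hd p) (hd q), add_apply, hp, hq]
  | mul_X p j hp =>
    have hj : HasFDerivAt (fun u : X m => ((u j : ℝ) : 𝕜))
        ((RCLike.ofRealCLM : ℝ →L[ℝ] 𝕜).comp (EuclideanSpace.proj j)) u :=
      ((RCLike.ofRealCLM : ℝ →L[ℝ] 𝕜).comp (EuclideanSpace.proj j)).hasFDerivAt
    simp only [map_mul, MvPolynomial.aeval_X]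
    rw [fderiv_fun_mul (hd p) hj.differentiableAt, hj.fderiv, Derivation.leibniz]
    simp only [add_apply, smul_apply, hp]
    by_cases h : j = i <;> simp [h, MvPolynomial.pderiv_X, mul_comm]

end PolynomialFunctions

/-! ### Polynomial-valued distributions and their operators. -/

open MvPolynomial hiding X

/-- Distributions on `ℝ^m` with values in the complex polynomials in `m` variables. -/
abbrev PolyDist (m : ℕ) := Test m → MvPolynomial (Fin m) ℂ

section Operators

variable {m : ℕ}

/-- The partial derivative `∂_{x_i}` of a polynomial-valued distribution. -/
def dX (i : Fin m) : Module.End ℂ (PolyDist m) where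
  toFun T φ := -T (∂_{(e i : X m)} φ)
  map_add' S T := by ext; simp [add_comm]
  map_smul' c T := by ext; simp

/-- The pointwise action of an operator on polynomials. -/
def pointwise (f : Module.End ℂ (MvPolynomial (Fin m) ℂ)) : Module.End ℂ (PolyDist m) where
  toFun T φ := f (T φ)
  map_add' S T := by ext; simp
  map_smul' c T := by ext; simp

/-- `⟨u, D_x⟩` on polynomial-valued distributions. -/
def opU : Module.End ℂ (PolyDist m) :=
  ∑ i, pointwise (LinearMap.mulLeft ℂ (MvPolynomial.X i)) * dX i

/-- `⟨D_u, D_x⟩` on polynomial-valued distributions. -/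
def opA : Module.End ℂ (PolyDist m) :=
  ∑ i, pointwise (pderiv i).toLinearMap * dX i

/-- `Δ_x` on polynomial-valued distributions. -/
def opL : Module.End ℂ (PolyDist m) := ∑ i, dX i * dX i

/-- The polynomial `‖u‖²`. -/
def normSq (m : ℕ) : MvPolynomial (Fin m) ℂ := ∑ i, MvPolynomial.X i * MvPolynomial.X i

/-- Multiplication of polynomial-valued distributions by `‖u‖²`. -/
def opρ : Module.End ℂ (PolyDist m) := pointwise (LinearMap.mulLeft ℂ (normSq m))

/-- The Euler operator on polynomials. -/
def euler (m : ℕ) : Module.End ℂ (MvPolynomial (Fin m) ℂ) :=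
  ∑ i, LinearMap.mulLeft ℂ (MvPolynomial.X i) * (pderiv i).toLinearMap

lemma polyLaplacian_apply (p : MvPolynomial (Fin m) ℂ) :
    polyLaplacian m p = ∑ i, pderiv i (pderiv i p) := by
  simp [polyLaplacian]

lemma euler_apply (p : MvPolynomial (Fin m) ℂ) : euler m p = ∑ i, MvPolynomial.X i * pderiv i p := by
  simp [euler]

lemma dX_apply (i : Fin m) (T : PolyDist m) (φ : Test m) :
    dX i T φ = -T (∂_{(e i : X m)} φ) := rfl

lemma opU_apply (T : PolyDist m) (φ : Test m) : opU T φ = ∑ i, MvPolynomial.X i * dX i T φ := by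
  simp [opU, pointwise]

lemma opA_apply (T : PolyDist m) (φ : Test m) : opA T φ = ∑ i, pderiv i (dX i T φ) := by
  simp [opA, pointwise]

lemma opL_apply (T : PolyDist m) (φ : Test m) : opL T φ = ∑ i, dX i (dX i T) φ := by
  simp [opL]

lemma opρ_apply (T : PolyDist m) (φ : Test m) : opρ T φ = normSq m * T φ := rfl

/-- The symmetry is that of second derivatives of the test function, so neither linearity nor
continuity of `T` enters. -/
lemma dX_comm (i j : Fin m) (T : PolyDist m) : dX i (dX j T) = dX j (dX i T) := by
  ext1 φ
  simp only [dX_apply, test_lineDeriv_comm φ (e i)]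

lemma pderiv_normSq (i : Fin m) : pderiv i (normSq m) = 2 * MvPolynomial.X i := by
  classical
  simp only [normSq, map_sum, pderiv_mul, pderiv_X, Pi.single_apply]
  simp [Finset.sum_add_distrib, two_mul]

/-- The only defect of commutation is ∂_{u_i} u_j = δ_{ij}, and its diagonal terms sum to Δ_x. -/
lemma opA_mul_opU : (opA * opU : Module.End ℂ (PolyDist m)) = opU * opA + opL := by
  classical
  refine LinearMap.ext fun T => funext fun φ => ?_
  have h : ∀ i : Fin m, dX i (opU T) φ = ∑ j, MvPolynomial.X j * dX i (dX j T) φ := by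
    intro i
    simp only [dX_apply i, opU_apply, Finset.sum_neg_distrib, mul_neg]
  have h2 : ∀ i : Fin m, dX i (opA T) φ = ∑ j, pderiv j (dX i (dX j T) φ) := by
    intro i
    simp only [dX_apply i, opA_apply, Finset.sum_neg_distrib, map_neg]
  have h3 : ∀ i j : Fin m, pderiv i (MvPolynomial.X j * dX i (dX j T) φ) =
      MvPolynomial.X j * pderiv i (dX j (dX i T) φ) + if i = j then dX i (dX i T) φ else 0 := by
    intro i j
    rw [pderiv_mul, pderiv_X, dX_comm i j, add_comm]
    congr 1
    by_cases hij : i = j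
    · subst hij; simp
    · simp [hij, Ne.symm hij]
  rw [LinearMap.add_apply, Pi.add_apply, Module.End.mul_apply, Module.End.mul_apply, opA_apply,
    opU_apply, opL_apply]
  simp only [h, h2, map_sum, h3, Finset.sum_add_distrib, Finset.mul_sum, Finset.sum_ite_eq,
    Finset.mem_univ, if_true]
  rw [Finset.sum_comm]

lemma opA_mul_opρ : (opA * opρ : Module.End ℂ (PolyDist m)) = opρ * opA + 2 * opU := by
  refine LinearMap.ext fun T => funext fun φ => ?_
  have h : ∀ i : Fin m, dX i (opρ T) φ = normSq m * dX i T φ := by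
    intro i
    simp only [dX_apply i, opρ_apply, mul_neg]
  have h2 : (2 * opU : Module.End ℂ (PolyDist m)) T φ = 2 * opU T φ := by
    rw [two_mul, LinearMap.add_apply, Pi.add_apply, two_mul]
  rw [LinearMap.add_apply, Pi.add_apply, h2]
  simp only [Module.End.mul_apply, opA_apply, opU_apply, opρ_apply, h,
    pderiv_mul, pderiv_normSq, Finset.sum_add_distrib, Finset.mul_sum]
  rw [add_comm]
  simp only [mul_assoc]

lemma commute_dX_pointwise (i : Fin m) (f : Module.End ℂ (MvPolynomial (Fin m) ℂ)) :
    Commute (dX i) (pointwise f) := by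
  refine LinearMap.ext fun T => funext fun φ => ?_
  simp [dX, pointwise]

lemma commute_dX_dX (i j : Fin m) : Commute (dX i) (dX j) :=
  LinearMap.ext fun T => dX_comm i j T

lemma commute_opL {f : Module.End ℂ (PolyDist m)} (h : ∀ i, Commute (dX i) f) : Commute opL f :=
  Finset.sum_induction _ (fun x => Commute x f) (fun _ _ ha hb => ha.add_left hb)
    (Commute.zero_left f) fun i _ => (h i).mul_left (h i)

lemma commute_dX_opU (i : Fin m) : Commute (dX i) opU :=
  Finset.sum_induction _ (fun x => Commute (dX i) x) (fun _ _ ha hb => ha.add_right hb)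
    (Commute.zero_right _) fun j _ => (commute_dX_pointwise i _).mul_right (commute_dX_dX i j)

lemma commute_dX_opA (i : Fin m) : Commute (dX i) opA :=
  Finset.sum_induction _ (fun x => Commute (dX i) x) (fun _ _ ha hb => ha.add_right hb)
    (Commute.zero_right _) fun j _ => (commute_dX_pointwise i _).mul_right (commute_dX_dX i j)

lemma commute_opL_opA : Commute (opL (m := m)) opA := commute_opL commute_dX_opA

lemma commute_opL_opU : Commute (opL (m := m)) opU := commute_opL commute_dX_opU

lemma commute_opL_opρ : Commute (opL (m := m)) opρ :=
  commute_opL fun i => commute_dX_pointwise i _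

end Operators

/-! ### Harmonic polynomials modulo ‖u‖². -/

section Harmonic

variable {m : ℕ}

/-- Homogeneous harmonic polynomials of degree `l`, described by the Euler operator. -/
def IsHarmonicOfDegree (l : ℂ) (p : MvPolynomial (Fin m) ℂ) : Prop :=
  polyLaplacian m p = 0 ∧ euler m p = l • p

lemma IsHarmonicOfDegree.add {l : ℂ} {p q : MvPolynomial (Fin m) ℂ}
    (hp : IsHarmonicOfDegree l p) (hq : IsHarmonicOfDegree l q) : IsHarmonicOfDegree l (p + q) :=
  ⟨by rw [map_add, hp.1, hq.1, add_zero], by rw [map_add, hp.2, hq.2, smul_add]⟩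

lemma IsHarmonicOfDegree.smul {l : ℂ} {p : MvPolynomial (Fin m) ℂ}
    (hp : IsHarmonicOfDegree l p) (c : ℂ) : IsHarmonicOfDegree l (c • p) :=
  ⟨by rw [map_smul, hp.1, smul_zero], by rw [map_smul, hp.2, smul_comm]⟩

lemma IsHarmonicOfDegree.neg {l : ℂ} {p : MvPolynomial (Fin m) ℂ}
    (hp : IsHarmonicOfDegree l p) : IsHarmonicOfDegree l (-p) := by
  simpa using hp.smul (-1)

lemma isHarmonicOfDegree_zero (l : ℂ) : IsHarmonicOfDegree l (0 : MvPolynomial (Fin m) ℂ) :=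
  ⟨map_zero _, by rw [map_zero, smul_zero]⟩

lemma IsHarmonicOfDegree.sum {l : ℂ} {ι : Type*} {s : Finset ι}
    {p : ι → MvPolynomial (Fin m) ℂ} (h : ∀ i ∈ s, IsHarmonicOfDegree l (p i)) :
    IsHarmonicOfDegree l (∑ i ∈ s, p i) :=
  Finset.sum_induction _ _ (fun _ _ => IsHarmonicOfDegree.add) (isHarmonicOfDegree_zero l) h

lemma pderiv_comm {ι : Type*} (i j : ι) (p : MvPolynomial ι ℂ) :
    pderiv i (pderiv j p) = pderiv j (pderiv i p) := by
  classical
  induction p using MvPolynomial.induction_on with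
  | C a => simp
  | add p q hp hq => simp [hp, hq]
  | mul_X p n hp =>
    simp only [pderiv_mul, map_add, hp, pderiv_X, Pi.single_apply]
    split_ifs <;> simp
    ring

lemma polyLaplacian_X_mul (i : Fin m) (p : MvPolynomial (Fin m) ℂ) :
    polyLaplacian m (MvPolynomial.X i * p) = MvPolynomial.X i * polyLaplacian m p + 2 * pderiv i p := by
  classical
  simp only [polyLaplacian_apply, pderiv_mul, map_add, pderiv_X, Pi.single_apply, Finset.mul_sum,
    Finset.sum_add_distrib]
  simp [apply_ite, ite_mul]
  ring

lemma polyLaplacian_normSq_mul (p : MvPolynomial (Fin m) ℂ) :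
    polyLaplacian m (normSq m * p) =
      normSq m * polyLaplacian m p + (2 * m : ℂ) • p + (4 : ℂ) • euler m p := by
  have h : ∀ i : Fin m, pderiv i (pderiv i (normSq m * p)) =
      normSq m * pderiv i (pderiv i p) + 2 * p + 4 * (MvPolynomial.X i * pderiv i p) := by
    intro i
    have h2 : pderiv i (2 : MvPolynomial (Fin m) ℂ) = 0 := by
      exact pderiv_C (R := ℂ) (a := 2)
    rw [pderiv_mul, pderiv_normSq, map_add, pderiv_mul, pderiv_mul, pderiv_mul, pderiv_normSq,
      pderiv_X_self, h2]
    ring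
  rw [polyLaplacian_apply, polyLaplacian_apply, euler_apply]
  simp only [h, Finset.sum_add_distrib, ← Finset.mul_sum, Finset.sum_const, Finset.card_univ,
    Fintype.card_fin, nsmul_eq_mul]
  simp only [Algebra.smul_def, map_mul, map_natCast, map_ofNat]
  ring

lemma polyLaplacian_pderiv (i : Fin m) (p : MvPolynomial (Fin m) ℂ) :
    polyLaplacian m (pderiv i p) = pderiv i (polyLaplacian m p) := by
  simp only [polyLaplacian_apply, map_sum]
  exact Finset.sum_congr rfl fun j _ => by rw [pderiv_comm j i, pderiv_comm j i]

lemma euler_mul (p q : MvPolynomial (Fin m) ℂ) :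
    euler m (p * q) = p * euler m q + euler m p * q := by
  simp only [euler_apply, pderiv_mul, mul_add, Finset.sum_add_distrib, Finset.mul_sum,
    Finset.sum_mul]
  rw [add_comm]
  congr 1 <;> exact Finset.sum_congr rfl fun _ _ => by ring

lemma euler_X (i : Fin m) : euler m (MvPolynomial.X i) = MvPolynomial.X i := by
  classical
  simp [euler_apply, pderiv_X, Pi.single_apply]

lemma euler_normSq : euler m (normSq m) = 2 * normSq m := by
  simp only [euler_apply, pderiv_normSq]
  rw [normSq, Finset.mul_sum]
  exact Finset.sum_congr rfl fun _ _ => by ring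

lemma euler_pderiv (i : Fin m) (p : MvPolynomial (Fin m) ℂ) :
    euler m (pderiv i p) = pderiv i (euler m p) - pderiv i p := by
  classical
  simp only [euler_apply, map_sum, pderiv_mul, pderiv_X, Pi.single_apply, Finset.sum_add_distrib]
  simp [pderiv_comm i, ite_mul]

lemma coeff_euler (p : MvPolynomial (Fin m) ℂ) (d : Fin m →₀ ℕ) :
    coeff d (euler m p) = (d.degree : ℂ) * coeff d p := by
  induction p using MvPolynomial.induction_on' with
  | monomial s a =>
    simp only [euler_apply, X_mul_pderiv_monomial, ← Finset.sum_smul, coeff_smul]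
    rw [← Finsupp.degree_eq_sum, coeff_monomial]
    split_ifs with h
    · subst h; simp
    · simp
  | add p q hp hq => simp [hp, hq, mul_add]

/-- A homogeneous harmonic polynomial divisible by `‖u‖²` vanishes. -/
theorem IsHarmonicOfDegree.eq_zero_of_dvd (hm : 0 < m) {l : ℂ} {p : MvPolynomial (Fin m) ℂ}
    (hp : IsHarmonicOfDegree l p) (hdvd : normSq m ∣ p) : p = 0 := by
  have hne : normSq m ≠ 0 := by
    intro h
    have := congrArg (MvPolynomial.eval (Pi.single (⟨0, hm⟩ : Fin m) (1 : ℂ))) h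
    simp [normSq, Pi.single_apply] at this
  -- If p = ‖u‖^{2(a+1)} g, then Δp = 0 expresses a nonzero multiple of g as a multiple of ‖u‖².
  -- Thus every power of ‖u‖² divides p, which forces p = 0.
  have hstep : ∀ a : ℕ, normSq m ^ (a + 1) ∣ p := by
    intro a
    induction a with
    | zero => simpa using hdvd
    | succ a ih =>
      obtain ⟨g, hg⟩ := ih
      by_cases hg0 : g = 0
      · simp [hg, hg0]
      have hepow : ∀ b : ℕ, euler m (normSq m ^ b) = (2 * b : ℂ) • normSq m ^ b := by
        intro b
        induction b with
        | zero => simp [euler_apply]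
        | succ b ihb =>
          rw [pow_succ, euler_mul, ihb, euler_normSq]
          simp only [Algebra.smul_def, map_mul, map_natCast, map_ofNat]
          push_cast
          ring
      have hlap : ∀ (b : ℕ) (q : MvPolynomial (Fin m) ℂ) (c : ℂ), euler m q = c • q →
          polyLaplacian m (normSq m ^ (b + 1) * q) = normSq m ^ (b + 1) * polyLaplacian m q +
            (2 * (b + 1) * (m + 2 * b + 2 * c) : ℂ) • (normSq m ^ b * q) := by
        intro b q c hq
        induction b with
        | zero =>
          rw [zero_add, pow_one, polyLaplacian_normSq_mul, hq]
          simp only [pow_zero, one_mul, Nat.cast_zero]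
          module
        | succ b ihb =>
          rw [pow_succ', mul_assoc, polyLaplacian_normSq_mul, ihb, euler_mul, hepow, hq]
          simp only [Algebra.smul_def, map_mul, map_natCast, map_ofNat, map_add, map_one]
          push_cast
          ring
      have hE : euler m g = (l - 2 * (a + 1)) • g := by
        have h1 := hp.2
        rw [hg, euler_mul, hepow] at h1
        have h2 : normSq m ^ (a + 1) * (euler m g - (l - 2 * (a + 1)) • g) = 0 := by
          have h3 := sub_eq_zero.2 h1
          rw [← h3]
          simp only [Algebra.smul_def, map_mul, map_natCast, map_ofNat, map_add, map_one, map_sub]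
          push_cast
          ring
        exact sub_eq_zero.1 ((mul_eq_zero.1 h2).resolve_left (pow_ne_zero _ hne))
      -- A nonzero coefficient of g identifies its Euler eigenvalue with a natural number, so the
      -- factor m + 2a + 2 deg g below is positive.
      obtain ⟨d, hd⟩ := MvPolynomial.ne_zero_iff.1 hg0
      have hdeg : l - 2 * (a + 1) = (d.degree : ℂ) := by
        have h1 := congrArg (coeff d) hE
        rw [coeff_euler, coeff_smul, smul_eq_mul] at h1
        exact (mul_right_cancel₀ hd h1).symm
      have h4 := hlap a g _ hE
      rw [← hg, hp.1, hdeg] at h4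
      have hc : (2 * (a + 1) * (m + 2 * a + 2 * d.degree) : ℂ) ≠ 0 := by
        have : 2 * (a + 1) * (m + 2 * a + 2 * d.degree) ≠ 0 := by positivity
        exact_mod_cast this
      have h5 : normSq m ^ a * (normSq m * polyLaplacian m g +
          (2 * (a + 1) * (m + 2 * a + 2 * d.degree) : ℂ) • g) = 0 := by
        rw [h4, mul_add, mul_smul_comm]
        ring
      have h6 := (mul_eq_zero.1 h5).resolve_left (pow_ne_zero _ hne)
      have h7 : normSq m ∣ g := by
        have h8 : (2 * (a + 1) * (m + 2 * a + 2 * d.degree) : ℂ) • g =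
            normSq m * (-polyLaplacian m g) := by
          rw [mul_neg]; exact eq_neg_of_add_eq_zero_right h6
        refine ⟨(2 * (a + 1) * (m + 2 * a + 2 * d.degree) : ℂ)⁻¹ • (-polyLaplacian m g), ?_⟩
        rw [mul_smul_comm, ← h8, smul_smul, inv_mul_cancel₀ hc, one_smul]
      rw [hg, pow_succ]
      exact mul_dvd_mul_left _ h7
  by_contra hp0
  have hunit : ¬ IsUnit (normSq m) := by
    intro h
    have := h.map (MvPolynomial.eval (0 : Fin m → ℂ))
    simp [normSq] at this
  obtain ⟨n, hn⟩ := FiniteMultiplicity.of_not_isUnit hunit hp0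
  exact hn (hstep n)

/-- The twistor operator preserves harmonicity. -/
lemma isHarmonicOfDegree_twistorOp {l w : ℂ} (hw : w = m / 2 + l - 1) (hw0 : w ≠ 0)
    {T : PolyDist m} (hT : ∀ φ, IsHarmonicOfDegree l (T φ)) (φ : Test m) :
    IsHarmonicOfDegree (l + 1) (twistorOp opA opU opρ w T φ) := by
  have hd : ∀ i, IsHarmonicOfDegree l (dX i T φ) := fun i => (hT _).neg
  have hA : IsHarmonicOfDegree (l - 1) (opA T φ) := by
    rw [opA_apply]
    refine IsHarmonicOfDegree.sum fun i _ => ⟨?_, ?_⟩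
    · rw [polyLaplacian_pderiv, (hd i).1, map_zero]
    · rw [euler_pderiv, (hd i).2, Derivation.map_smul, sub_smul, one_smul]
  have e1 : twistorOp opA opU opρ w T φ = opU T φ - (1 / (2 * w)) • (normSq m * opA T φ) := by
    simp [twistorOp, opρ_apply]
  -- On the other side Δ_u(‖u‖² A T) = (2m + 4(l-1)) A T = 4w A T, so the weight 1/(2w) is exactly
  -- what cancels 2 A T.
  have hU1 : polyLaplacian m (opU T φ) = (2 : ℂ) • opA T φ := by
    rw [opU_apply, opA_apply, map_sum, Finset.smul_sum]
    refine Finset.sum_congr rfl fun i _ => ?_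
    rw [polyLaplacian_X_mul, (hd i).1, mul_zero, zero_add, Algebra.smul_def, map_ofNat]
  have hU2 : euler m (opU T φ) = (l + 1) • opU T φ := by
    rw [opU_apply, map_sum, Finset.smul_sum]
    refine Finset.sum_congr rfl fun i _ => ?_
    rw [euler_mul, euler_X, (hd i).2, add_smul, one_smul, mul_smul_comm]
  rw [e1]
  constructor
  · rw [map_sub, map_smul, polyLaplacian_normSq_mul, hU1, hA.1, hA.2, mul_zero, zero_add, smul_smul,
      ← add_smul, smul_smul, ← sub_smul]
    convert zero_smul ℂ _
    field_simp
    rw [hw]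
    ring
  · rw [map_sub, map_smul, euler_mul, euler_normSq, hU2, hA.2]
    simp only [Algebra.smul_def, map_add, map_one, map_sub]
    ring

end Harmonic

/-! ### Distributions ‖x‖^a Q(x, u) with Q polynomial. -/

section PowerDist

variable {m : ℕ}

/-- Polynomials in the variables `x_i` (`Sum.inl i`) and `u_i` (`Sum.inr i`). -/
abbrev Poly₂ (m : ℕ) := MvPolynomial (Fin m ⊕ Fin m) ℂ

/-- The exponents of the variables `x_i`. -/
def xPart (γ : Fin m ⊕ Fin m →₀ ℕ) : Fin m →₀ ℕ :=
  γ.comapDomain Sum.inl Sum.inl_injective.injOn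

/-- The exponents of the variables `u_i`. -/
def uPart (γ : Fin m ⊕ Fin m →₀ ℕ) : Fin m →₀ ℕ :=
  γ.comapDomain Sum.inr Sum.inr_injective.injOn

/-- The real monomial function with exponents `α`. -/
def monoFun (α : Fin m →₀ ℕ) (x : X m) : ℝ := ∏ i, x i ^ α i

/-- The weight counting the degree in `x`. -/
def wx : Fin m ⊕ Fin m → ℕ := Sum.elim 1 0

lemma weight_wx (γ : Fin m ⊕ Fin m →₀ ℕ) : Finsupp.weight wx γ = ∑ i, xPart γ i := by
  rw [Finsupp.weight_apply, Finsupp.sum_fintype _ _ (by simp)]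
  simp [wx, xPart]

lemma monoFun_single_add (i : Fin m) (α : Fin m →₀ ℕ) (x : X m) :
    monoFun (Finsupp.single i 1 + α) x = x i * monoFun α x := by
  classical
  simp only [monoFun, Finsupp.add_apply, pow_add, Finset.prod_mul_distrib]
  congr 1
  rw [Finset.prod_eq_single i] <;> simp +contextual [eq_comm]

lemma monoFun_eq_aeval (α : Fin m →₀ ℕ) (c : ℝ) (x : X m) :
    aeval (fun i => (RCLike.ofReal (x i) : ℝ)) (monomial α c) = c * monoFun α x := by
  rw [aeval_monomial, Finsupp.prod_fintype _ _ (by simp)]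
  simp [monoFun]

lemma monoFun_eq_aeval_one (α : Fin m →₀ ℕ) :
    monoFun α = fun x : X m => aeval (fun i => (RCLike.ofReal (x i) : ℝ)) (monomial α (1 : ℝ)) :=
  funext fun x => by rw [monoFun_eq_aeval, one_mul]

lemma contDiff_monoFun (α : Fin m →₀ ℕ) : ContDiff ℝ 1 (monoFun α) := by
  rw [monoFun_eq_aeval_one]
  exact contDiff_aeval (𝕜 := ℝ) (monomial α 1)

lemma fderiv_monoFun (α : Fin m →₀ ℕ) (x : X m) (i : Fin m) :
    fderiv ℝ (monoFun α) x (e i) = α i * monoFun (α - Finsupp.single i 1) x := by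
  rw [monoFun_eq_aeval_one, fderiv_aeval, pderiv_monomial, monoFun_eq_aeval, one_mul]

lemma abs_monoFun_le (α : Fin m →₀ ℕ) (x : X m) : |monoFun α x| ≤ ‖x‖ ^ (∑ i, α i) := by
  rw [monoFun, Finset.abs_prod, ← Finset.prod_pow_eq_pow_sum]
  refine Finset.prod_le_prod (fun i _ => abs_nonneg _) fun i _ => ?_
  rw [abs_pow]
  gcongr
  exact PiLp.norm_apply_le x i

/-- The distribution `φ ↦ ∫ φ(x) ‖x‖^a Q(x, ·) dx` for a polynomial `Q(x, u)`. -/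
def powerDist (a : ℝ) : Poly₂ m →ₗ[ℂ] PolyDist m :=
  (basisMonomials (Fin m ⊕ Fin m) ℂ).constr ℂ fun γ φ =>
    monomial (uPart γ) ((∫ x, φ x * (‖x‖ ^ a * monoFun (xPart γ) x) : ℝ) : ℂ)

lemma powerDist_monomial (a : ℝ) (γ : Fin m ⊕ Fin m →₀ ℕ) (c : ℂ) (φ : Test m) :
    powerDist a (monomial γ c) φ =
      monomial (uPart γ) (c * ((∫ x, φ x * (‖x‖ ^ a * monoFun (xPart γ) x) : ℝ) : ℂ)) := by
  have h : monomial γ c = c • basisMonomials (Fin m ⊕ Fin m) ℂ γ := by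
    simp [smul_monomial]
  rw [h, map_smul, powerDist, Module.Basis.constr_basis, Pi.smul_apply, smul_monomial, smul_eq_mul]

lemma xPart_single_inl_add (i : Fin m) (γ : Fin m ⊕ Fin m →₀ ℕ) :
    xPart (Finsupp.single (Sum.inl i) 1 + γ) = Finsupp.single i 1 + xPart γ := by
  classical
  ext j; simp [xPart, Finsupp.single_apply]

lemma xPart_single_inr_add (i : Fin m) (γ : Fin m ⊕ Fin m →₀ ℕ) :
    xPart (Finsupp.single (Sum.inr i) 1 + γ) = xPart γ := by
  ext j; simp [xPart]

lemma uPart_single_inl_add (i : Fin m) (γ : Fin m ⊕ Fin m →₀ ℕ) :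
    uPart (Finsupp.single (Sum.inl i) 1 + γ) = uPart γ := by
  ext j; simp [uPart]

lemma uPart_single_inr_add (i : Fin m) (γ : Fin m ⊕ Fin m →₀ ℕ) :
    uPart (Finsupp.single (Sum.inr i) 1 + γ) = Finsupp.single i 1 + uPart γ := by
  classical
  ext j; simp [uPart, Finsupp.single_apply]

lemma xPart_sub_inl (i : Fin m) (γ : Fin m ⊕ Fin m →₀ ℕ) :
    xPart (γ - Finsupp.single (Sum.inl i) 1) = xPart γ - Finsupp.single i 1 := by
  classical
  ext j; simp [xPart, Finsupp.single_apply]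

lemma xPart_sub_inr (i : Fin m) (γ : Fin m ⊕ Fin m →₀ ℕ) :
    xPart (γ - Finsupp.single (Sum.inr i) 1) = xPart γ := by
  ext j; simp [xPart]

lemma uPart_sub_inl (i : Fin m) (γ : Fin m ⊕ Fin m →₀ ℕ) :
    uPart (γ - Finsupp.single (Sum.inl i) 1) = uPart γ := by
  ext j; simp [uPart]

lemma uPart_sub_inr (i : Fin m) (γ : Fin m ⊕ Fin m →₀ ℕ) :
    uPart (γ - Finsupp.single (Sum.inr i) 1) = uPart γ - Finsupp.single i 1 := by
  classical
  ext j; simp [uPart, Finsupp.single_apply]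

lemma X_mul_monomial' {σ : Type*} (i : σ) (γ : σ →₀ ℕ) (c : ℂ) :
    MvPolynomial.X i * monomial γ c = monomial (Finsupp.single i 1 + γ) c := by
  rw [MvPolynomial.X, monomial_mul, one_mul]

lemma powerDist_X_inr_mul (a : ℝ) (i : Fin m) (Q : Poly₂ m) (φ : Test m) :
    powerDist a (MvPolynomial.X (Sum.inr i) * Q) φ = MvPolynomial.X i * powerDist a Q φ := by
  induction Q using MvPolynomial.induction_on' with
  | monomial γ c =>
    rw [X_mul_monomial', powerDist_monomial, powerDist_monomial, X_mul_monomial',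
      xPart_single_inr_add, uPart_single_inr_add]
  | add p q hp hq => rw [mul_add, map_add, map_add, Pi.add_apply, Pi.add_apply, hp, hq, mul_add]

lemma powerDist_pderiv_inr (a : ℝ) (i : Fin m) (Q : Poly₂ m) (φ : Test m) :
    powerDist a (pderiv (Sum.inr i) Q) φ = pderiv i (powerDist a Q φ) := by
  induction Q using MvPolynomial.induction_on' with
  | monomial γ c =>
    rw [pderiv_monomial, powerDist_monomial, powerDist_monomial, pderiv_monomial, xPart_sub_inr,
      uPart_sub_inr]
    congr 1
    simp only [uPart, Finsupp.comapDomain_apply]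
    ring
  | add p q hp hq => rw [map_add, map_add, map_add, Pi.add_apply, Pi.add_apply, hp, hq, map_add]

lemma integrable_monoFun (hm : 1 ≤ m) {a : ℝ} (α : Fin m →₀ ℕ)
    (ha : -(m : ℝ) < a + (∑ i, α i : ℕ)) (φ : Test m) :
    Integrable fun x => φ x * (‖x‖ ^ a * monoFun α x) := by
  have hmeas : Measurable fun x : X m => ‖x‖ ^ a := by fun_prop
  refine integrable_test_mul (locallyIntegrable_norm_rpow_mul (C := 1) hm ha
    (hmeas.aestronglyMeasurable.mul (contDiff_monoFun α).continuous.aestronglyMeasurable)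
    fun x hx => ?_) φ
  have hn : 0 < ‖x‖ := norm_pos_iff.2 hx
  rw [Pi.mul_apply, abs_mul, abs_of_nonneg (by positivity), Real.rpow_add hn, Real.rpow_natCast,
    one_mul]
  gcongr
  exact abs_monoFun_le α x

/-- The product rule with ∂_i ‖x‖^a = a ‖x‖^{a-2} x_i. The bound on a + d - 1 keeps the derivative
locally integrable, so no mass appears at 0. -/
lemma dX_powerDist (hm : 1 ≤ m) {a : ℝ} {d : ℕ} {Q : Poly₂ m} (hQ : IsWeightedHomogeneous wx Q d)
    (had : -(m : ℝ) < a + d - 1) (i : Fin m) :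
    dX i (powerDist a Q) = (a : ℂ) • powerDist (a - 2) (MvPolynomial.X (Sum.inl i) * Q) +
      powerDist a (pderiv (Sum.inl i) Q) := by
  induction hQ using IsWeightedHomogeneous.induction_on with
  | zero => simp
  | add p q _ _ hp hq => rw [map_add, map_add, hp, hq, mul_add, map_add, map_add, map_add]; module
  | monomial γ c hγ =>
    funext φ
    rw [weight_wx] at hγ
    -- With α the exponent of x, the constant 1 + α_i dominates both the 1 in the bound for x^α and
    -- the α_i in the bound for its derivative.
    have key := integral_lineDeriv_norm_rpow_mul (a := a) (d := d) (C := 1 + xPart γ i) hm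
      (contDiff_monoFun (xPart γ)) i had (fun x hx => ?_) (fun x hx => ?_) φ
    · rw [dX_apply, Pi.add_apply, Pi.smul_apply, powerDist_monomial, X_mul_monomial',
        powerDist_monomial, pderiv_monomial, powerDist_monomial, xPart_single_inl_add,
        uPart_single_inl_add, xPart_sub_inl, uPart_sub_inl, smul_monomial, ← map_add, ← map_neg]
      congr 1
      simp only [monoFun_single_add]
      simp only [fderiv_monoFun] at key
      have h2 : ∫ x, φ x * (‖x‖ ^ a * (xPart γ i * monoFun (xPart γ - Finsupp.single i 1) x)) =
          xPart γ i * ∫ x, φ x * (‖x‖ ^ a * monoFun (xPart γ - Finsupp.single i 1) x) := by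
        rw [← integral_const_mul]
        exact integral_congr_ae (.of_forall fun x => by ring)
      rw [h2] at key
      have h3 : xPart γ i = γ (Sum.inl i) := rfl
      rw [← mul_neg, ← Complex.ofReal_neg, key, h3]
      push_cast
      rw [smul_eq_mul]
      ring
    · have hn : 0 < ‖x‖ := norm_pos_iff.2 hx
      rw [Real.rpow_natCast, ← hγ]
      refine (abs_monoFun_le _ x).trans (le_mul_of_one_le_left (by positivity) ?_)
      linarith [(Nat.cast_nonneg (xPart γ i) : (0 : ℝ) ≤ _)]
    · have hn : 0 < ‖x‖ := norm_pos_iff.2 hx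
      rw [fderiv_monoFun]
      -- For exponent 0 the derivative vanishes; otherwise the truncated subtraction is genuine and
      -- lowers the degree by one.
      by_cases h0 : xPart γ i = 0
      · simp only [h0]
        simp
        positivity
      have hs : ∑ j, (xPart γ - Finsupp.single i 1 : Fin m →₀ ℕ) j + 1 = d := by
        have h1 : Finsupp.single i 1 + (xPart γ - Finsupp.single i 1) = xPart γ :=
          add_tsub_cancel_of_le (by simpa [Nat.one_le_iff_ne_zero] using h0)
        rw [← hγ]
        conv_rhs => rw [← h1]
        simp [Finset.sum_add_distrib, add_comm]
      have hd1 : (d : ℝ) - 1 = ((∑ j, (xPart γ - Finsupp.single i 1 : Fin m →₀ ℕ) j : ℕ) : ℝ) := by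
        rw [← hs]; push_cast; ring
      rw [hd1, Real.rpow_natCast, abs_mul, Nat.abs_cast]
      gcongr
      · linarith
      · exact abs_monoFun_le _ x

/-- The polynomial `‖x‖²`. -/
def xNormSq (m : ℕ) : Poly₂ m := ∑ i, MvPolynomial.X (Sum.inl i) * MvPolynomial.X (Sum.inl i)

/-- The integrands agree off the null set {0}. The degree condition makes each summand x_i²
integrable, so that sum and integral can be exchanged. -/
lemma powerDist_xNormSq_mul (hm : 1 ≤ m) {a : ℝ} {d : ℕ} {Q : Poly₂ m}
    (hQ : IsWeightedHomogeneous wx Q d) (had : -(m : ℝ) < a + 2 + d) :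
    powerDist a (xNormSq m * Q) = powerDist (a + 2) Q := by
  have : Nonempty (Fin m) := ⟨⟨0, hm⟩⟩
  induction hQ using IsWeightedHomogeneous.induction_on with
  | zero => simp
  | add p q _ _ hp hq => rw [mul_add, map_add, map_add, hp, hq]
  | monomial γ c hγ =>
    funext φ
    rw [weight_wx] at hγ
    rw [xNormSq, Finset.sum_mul, map_sum, Finset.sum_apply]
    simp only [mul_assoc, X_mul_monomial', powerDist_monomial, uPart_single_inl_add,
      xPart_single_inl_add]
    rw [← map_sum, ← Finset.mul_sum, ← Complex.ofReal_sum, ← integral_finsetSum]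
    · congr 3
      refine integral_congr_ae ?_
      filter_upwards [Measure.ae_ne volume (0 : X m)] with x hx
      have hn : 0 < ‖x‖ := norm_pos_iff.2 hx
      have h2 : ‖x‖ ^ (2 : ℝ) = ∑ i, x i ^ 2 := by
        rw [Real.rpow_two, EuclideanSpace.real_norm_sq_eq]
      simp only [monoFun_single_add, Real.rpow_add hn, h2, Finset.sum_mul, Finset.mul_sum]
      exact Finset.sum_congr rfl fun i _ => by ring
    · intro i _
      refine integrable_monoFun hm _ ?_ φ
      simp only [Finsupp.add_apply, Finset.sum_add_distrib, hγ]
      simp [Finsupp.single_apply]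
      linarith

end PowerDist

/-! ### Taylor coefficients of p(u + t x) and harmonicity of the reflected polynomial. -/

section Taylor

variable {m : ℕ}

/-- The operator `⟨x, D_u⟩` on polynomials in `x` and `u`. -/
def xDu (m : ℕ) : Module.End ℂ (Poly₂ m) :=
  ∑ i, LinearMap.mulLeft ℂ (MvPolynomial.X (Sum.inl i)) * (pderiv (Sum.inr i)).toLinearMap

/-- The Laplacian in `u` on polynomials in `x` and `u`. -/
def laplacianU (m : ℕ) : Module.End ℂ (Poly₂ m) :=
  ∑ i, (pderiv (Sum.inr i)).toLinearMap * (pderiv (Sum.inr i)).toLinearMap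

/-- The Euler operator in `u` on polynomials in `x` and `u`. -/
def eulerU (m : ℕ) : Module.End ℂ (Poly₂ m) :=
  ∑ i, LinearMap.mulLeft ℂ (MvPolynomial.X (Sum.inr i)) * (pderiv (Sum.inr i)).toLinearMap

/-- The polynomial `⟨x, u⟩`. -/
def pairing (m : ℕ) : Poly₂ m := ∑ i, MvPolynomial.X (Sum.inl i) * MvPolynomial.X (Sum.inr i)

lemma xDu_apply (Q : Poly₂ m) :
    xDu m Q = ∑ i, MvPolynomial.X (Sum.inl i) * pderiv (Sum.inr i) Q := by
  simp [xDu]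

lemma laplacianU_apply (Q : Poly₂ m) :
    laplacianU m Q = ∑ i, pderiv (Sum.inr i) (pderiv (Sum.inr i) Q) := by
  simp [laplacianU]

lemma eulerU_apply (Q : Poly₂ m) :
    eulerU m Q = ∑ i, MvPolynomial.X (Sum.inr i) * pderiv (Sum.inr i) Q := by
  simp [eulerU]

/-- The Taylor coefficients: `p (u + t x) = ∑ t ^ j taylor p j`. -/
def taylor (p : MvPolynomial (Fin m) ℂ) : ℕ → Poly₂ m
  | 0 => rename Sum.inr p
  | j + 1 => (1 / ((j : ℂ) + 1)) • xDu m (taylor p j)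

lemma xDu_taylor (p : MvPolynomial (Fin m) ℂ) (j : ℕ) :
    xDu m (taylor p j) = ((j : ℂ) + 1) • taylor p (j + 1) := by
  have : (j : ℂ) + 1 ≠ 0 := by exact_mod_cast j.succ_ne_zero
  rw [taylor, smul_smul, mul_one_div_cancel this, one_smul]

lemma pderiv_inr_X_inl (i j : Fin m) :
    pderiv (Sum.inr i : Fin m ⊕ Fin m) (MvPolynomial.X (Sum.inl j) : Poly₂ m) = 0 :=
  pderiv_X_of_ne (by simp)

lemma pderiv_inl_X_inr (i j : Fin m) :
    pderiv (Sum.inl i : Fin m ⊕ Fin m) (MvPolynomial.X (Sum.inr j) : Poly₂ m) = 0 :=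
  pderiv_X_of_ne (by simp)

lemma pderiv_inr_xDu (i : Fin m) (Q : Poly₂ m) :
    pderiv (Sum.inr i) (xDu m Q) = xDu m (pderiv (Sum.inr i) Q) := by
  simp only [xDu_apply, map_sum, pderiv_mul, pderiv_inr_X_inl, zero_mul, zero_add]
  exact Finset.sum_congr rfl fun j _ => by rw [pderiv_comm]

lemma pderiv_inl_xDu (i : Fin m) (Q : Poly₂ m) :
    pderiv (Sum.inl i) (xDu m Q) =
      pderiv (Sum.inr i) Q + xDu m (pderiv (Sum.inl i) Q) := by
  rw [xDu_apply, xDu_apply, map_sum]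
  simp only [pderiv_mul, Finset.sum_add_distrib]
  refine congrArg₂ (· + ·) ?_ ?_
  · rw [Finset.sum_eq_single i]
    · rw [pderiv_X_self, one_mul]
    · intro j _ hj
      rw [pderiv_X_of_ne (by simpa using hj), zero_mul]
    · simp
  · exact Finset.sum_congr rfl fun j _ => by rw [pderiv_comm (Sum.inl i)]

lemma pderiv_inl_taylor_zero (p : MvPolynomial (Fin m) ℂ) (i : Fin m) :
    pderiv (Sum.inl i) (taylor p 0) = 0 := by
  rw [taylor]
  induction p using MvPolynomial.induction_on with
  | C a => simp
  | add p q hp hq => simp [hp, hq]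
  | mul_X p j hp => rw [map_mul, pderiv_mul, hp, rename_X, pderiv_inl_X_inr]; simp

/-- Differentiating p(u + t x) in x_i is t times differentiating it in u_i. -/
lemma pderiv_inl_taylor_succ (p : MvPolynomial (Fin m) ℂ) (i : Fin m) (j : ℕ) :
    pderiv (Sum.inl i) (taylor p (j + 1)) = pderiv (Sum.inr i) (taylor p j) := by
  induction j with
  | zero => simp [taylor.eq_2, pderiv_inl_xDu, pderiv_inl_taylor_zero]
  | succ j ih =>
    have hj : (j : ℂ) + 1 + 1 ≠ 0 := by exact_mod_cast (j + 1).succ_ne_zero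
    rw [taylor.eq_2, Derivation.map_smul, pderiv_inl_xDu, ih, ← pderiv_inr_xDu, xDu_taylor,
      Derivation.map_smul]
    nth_rewrite 1 [← one_smul ℂ (pderiv (Sum.inr i) (taylor p (j + 1)))]
    rw [← add_smul, smul_smul]
    convert one_smul ℂ _
    push_cast
    field_simp
    ring

lemma laplacianU_xDu (Q : Poly₂ m) : laplacianU m (xDu m Q) = xDu m (laplacianU m Q) := by
  simp only [laplacianU_apply, pderiv_inr_xDu, map_sum]

lemma laplacianU_taylor {p : MvPolynomial (Fin m) ℂ} (hp : polyLaplacian m p = 0) (j : ℕ) :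
    laplacianU m (taylor p j) = 0 := by
  induction j with
  | zero =>
    rw [taylor, laplacianU_apply]
    simp only [pderiv_rename Sum.inr_injective]
    rw [← map_sum, ← polyLaplacian_apply, hp, map_zero]
  | succ j ih => rw [taylor, map_smul, laplacianU_xDu, ih, map_zero, smul_zero]

lemma eulerU_mul (P Q : Poly₂ m) : eulerU m (P * Q) = P * eulerU m Q + eulerU m P * Q := by
  simp only [eulerU_apply, pderiv_mul, mul_add, Finset.sum_add_distrib, Finset.mul_sum,
    Finset.sum_mul]
  rw [add_comm]
  exact congrArg₂ (· + ·) (Finset.sum_congr rfl fun _ _ => by ring)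
    (Finset.sum_congr rfl fun _ _ => by ring)

lemma eulerU_pderiv (i : Fin m) (Q : Poly₂ m) :
    eulerU m (pderiv (Sum.inr i) Q) = pderiv (Sum.inr i) (eulerU m Q) - pderiv (Sum.inr i) Q := by
  classical
  simp only [eulerU_apply, map_sum, pderiv_mul, pderiv_X, Pi.single_apply, Finset.sum_add_distrib]
  simp [pderiv_comm (Sum.inr i), ite_mul]

lemma eulerU_X_inl (i : Fin m) : eulerU m (MvPolynomial.X (Sum.inl i)) = 0 := by
  simp [eulerU_apply]

lemma eulerU_xDu (Q : Poly₂ m) : eulerU m (xDu m Q) = xDu m (eulerU m Q) - xDu m Q := by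
  rw [xDu_apply, map_sum, xDu_apply, ← Finset.sum_sub_distrib]
  refine Finset.sum_congr rfl fun i _ => ?_
  rw [eulerU_mul, eulerU_X_inl, eulerU_pderiv]
  ring

lemma eulerU_taylor {p : MvPolynomial (Fin m) ℂ} {k : ℕ} (hp : euler m p = (k : ℂ) • p) (j : ℕ) :
    eulerU m (taylor p j) = ((k : ℂ) - j) • taylor p j := by
  induction j with
  | zero =>
    have h := congrArg (rename (Sum.inr : Fin m → Fin m ⊕ Fin m)) hp
    rw [euler_apply, map_sum, map_smul] at h
    simp only [map_mul, rename_X, ← pderiv_rename Sum.inr_injective] at h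
    simpa [taylor, eulerU_apply] using h
  | succ j ih =>
    rw [taylor, map_smul, eulerU_xDu, ih, map_smul]
    push_cast
    module

lemma coeff_eulerU (Q : Poly₂ m) (γ : Fin m ⊕ Fin m →₀ ℕ) :
    coeff γ (eulerU m Q) = ((∑ i, γ (Sum.inr i) : ℕ) : ℂ) * coeff γ Q := by
  induction Q using MvPolynomial.induction_on' with
  | monomial s a =>
    simp only [eulerU_apply, X_mul_pderiv_monomial, ← Finset.sum_smul, coeff_smul]
    rw [coeff_monomial]
    split_ifs with h
    · subst h; simp
    · simp
  | add p q hp hq => simp [hp, hq, mul_add]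

/-- Its degree in u would have to be k - j, which is negative. -/
lemma taylor_eq_zero {p : MvPolynomial (Fin m) ℂ} {k : ℕ} (hp : euler m p = (k : ℂ) • p) {j : ℕ}
    (hj : k < j) : taylor p j = 0 := by
  ext γ
  have h := congrArg (coeff γ) (eulerU_taylor hp j)
  rw [coeff_eulerU, coeff_smul, smul_eq_mul, ← sub_eq_zero, ← sub_mul] at h
  refine (mul_eq_zero.1 h).resolve_left ?_
  have : (∑ i, γ (Sum.inr i)) + j - k ≠ 0 := by omega
  have h2 : (((∑ i, γ (Sum.inr i) + j - k : ℕ)) : ℂ) ≠ 0 := by exact_mod_cast this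
  rw [Nat.cast_sub (by omega)] at h2
  intro h3
  apply h2
  rw [← h3]
  push_cast
  ring

lemma isWeightedHomogeneous_xDu {Q : Poly₂ m} {d : ℕ} (hQ : IsWeightedHomogeneous wx Q d) :
    IsWeightedHomogeneous wx (xDu m Q) (d + 1) := by
  rw [xDu_apply]
  refine IsWeightedHomogeneous.sum _ _ _ fun i _ => ?_
  rw [add_comm]
  exact (isWeightedHomogeneous_X ℂ wx (Sum.inl i)).mul (hQ.pderiv (by simp [wx]))

lemma isWeightedHomogeneous_taylor (p : MvPolynomial (Fin m) ℂ) (j : ℕ) :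
    IsWeightedHomogeneous wx (taylor p j) j := by
  induction j with
  | zero =>
    rw [taylor]
    induction p using MvPolynomial.induction_on with
    | C a => simpa using isWeightedHomogeneous_C wx a
    | add p q hp hq => simpa using hp.add hq
    | mul_X p i hp =>
      rw [map_mul, rename_X]
      simpa [wx] using hp.mul (isWeightedHomogeneous_X ℂ wx (Sum.inr i))
  | succ j ih =>
    rw [taylor, smul_eq_C_mul]
    exact (isWeightedHomogeneous_xDu ih).C_mul _

lemma isWeightedHomogeneous_pairing : IsWeightedHomogeneous wx (pairing m) 1 :=
  IsWeightedHomogeneous.sum _ _ _ fun i _ =>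
    (isWeightedHomogeneous_X ℂ wx (Sum.inl i)).mul (isWeightedHomogeneous_X ℂ wx (Sum.inr i))

lemma isWeightedHomogeneous_pairing_pow_mul {Q : Poly₂ m} {d : ℕ}
    (hQ : IsWeightedHomogeneous wx Q d) (i : ℕ) :
    IsWeightedHomogeneous wx (pairing m ^ i * Q) (i + d) := by
  simpa using (isWeightedHomogeneous_pairing.pow i).mul hQ

lemma pderiv_inr_pairing (i : Fin m) :
    pderiv (Sum.inr i) (pairing m) = MvPolynomial.X (Sum.inl i) := by
  classical
  rw [pairing, map_sum, Finset.sum_eq_single i]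
  · rw [pderiv_mul, pderiv_inr_X_inl, pderiv_X_self]; simp
  · intro j _ hj
    rw [pderiv_mul, pderiv_inr_X_inl, pderiv_X_of_ne (by simpa using hj)]; simp
  · simp

lemma pderiv_inl_pairing (i : Fin m) :
    pderiv (Sum.inl i) (pairing m) = MvPolynomial.X (Sum.inr i) := by
  classical
  rw [pairing, map_sum, Finset.sum_eq_single i]
  · rw [pderiv_mul, pderiv_inl_X_inr, pderiv_X_self]; simp
  · intro j _ hj
    rw [pderiv_mul, pderiv_inl_X_inr, pderiv_X_of_ne (by simpa using hj)]; simp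
  · simp

lemma eulerU_pairing : eulerU m (pairing m) = pairing m := by
  simp only [eulerU_apply, pderiv_inr_pairing]
  exact Finset.sum_congr rfl fun _ _ => mul_comm _ _

lemma xDu_pairing_mul (Q : Poly₂ m) :
    xDu m (pairing m * Q) = xNormSq m * Q + pairing m * xDu m Q := by
  simp only [xDu_apply, pderiv_mul, pderiv_inr_pairing, mul_add, Finset.sum_add_distrib,
    xNormSq, Finset.sum_mul, Finset.mul_sum]
  exact congrArg₂ (· + ·) (Finset.sum_congr rfl fun _ _ => by ring)
    (Finset.sum_congr rfl fun _ _ => by ring)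

lemma laplacianU_pairing_mul (Q : Poly₂ m) :
    laplacianU m (pairing m * Q) = pairing m * laplacianU m Q + 2 * xDu m Q := by
  simp only [laplacianU_apply, xDu_apply, pderiv_mul, map_add, pderiv_inr_pairing,
    pderiv_inr_X_inl, Finset.mul_sum]
  rw [← Finset.sum_add_distrib]
  exact Finset.sum_congr rfl fun _ _ => by ring

lemma xDu_pairing_pow_mul (i : ℕ) (Q : Poly₂ m) :
    xDu m (pairing m ^ (i + 1) * Q) =
      (i + 1 : ℂ) • (xNormSq m * (pairing m ^ i * Q)) + pairing m ^ (i + 1) * xDu m Q := by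
  induction i with
  | zero => simp [xDu_pairing_mul]
  | succ i ih =>
    rw [pow_succ', mul_assoc, xDu_pairing_mul, ih]
    simp only [Algebra.smul_def, map_add, map_natCast, map_one]
    push_cast
    ring

lemma laplacianU_pairing_pow_mul (i : ℕ) {Q : Poly₂ m} (hQ : laplacianU m Q = 0) :
    laplacianU m (pairing m ^ (i + 2) * Q) =
      ((i + 2) * (i + 1) : ℂ) • (xNormSq m * (pairing m ^ i * Q)) +
        (2 * (i + 2) : ℂ) • (pairing m ^ (i + 1) * xDu m Q) := by
  induction i with
  | zero =>
    rw [zero_add, pow_two, mul_assoc, laplacianU_pairing_mul, laplacianU_pairing_mul, hQ,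
      xDu_pairing_mul]
    simp only [Algebra.smul_def, map_mul, map_add, map_natCast, map_one, map_ofNat]
    push_cast
    ring
  | succ i ih =>
    rw [show i + 1 + 2 = (i + 2) + 1 by ring, pow_succ', mul_assoc, laplacianU_pairing_mul, ih,
      xDu_pairing_pow_mul]
    simp only [Algebra.smul_def, map_mul, map_add, map_natCast, map_one, map_ofNat]
    push_cast
    ring

/-- The polynomials `∑ (-2)^i Λ_i (⟨x, u⟩^i p_i)` are harmonic if `Λ_i` behaves like an evaluation
at `x`, divided by `‖x‖^{2i}`. -/
theorem isHarmonicOfDegree_reflection {p : MvPolynomial (Fin m) ℂ} {k : ℕ}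
    (hp : IsHarmonicOfDegree k p) (Λ : ℕ → Poly₂ m →ₗ[ℂ] MvPolynomial (Fin m) ℂ)
    (hX : ∀ n i Q, Λ n (MvPolynomial.X (Sum.inr i) * Q) = MvPolynomial.X i * Λ n Q)
    (hD : ∀ n i Q, Λ n (pderiv (Sum.inr i) Q) = pderiv i (Λ n Q))
    (hr : ∀ i, Λ (i + 2) (xNormSq m * (pairing m ^ i * taylor p (i + 2))) =
      Λ (i + 1) (pairing m ^ i * taylor p (i + 2))) :
    IsHarmonicOfDegree k
      (∑ i ∈ Finset.range (k + 1), (-2 : ℂ) ^ i • Λ i (pairing m ^ i * taylor p i)) := by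
  have hlap : ∀ n Q, polyLaplacian m (Λ n Q) = Λ n (laplacianU m Q) := by
    intro n Q
    rw [laplacianU_apply, polyLaplacian_apply, map_sum]
    simp only [hD]
  have heul : ∀ n Q, euler m (Λ n Q) = Λ n (eulerU m Q) := by
    intro n Q
    rw [eulerU_apply, euler_apply, map_sum]
    simp only [hD, hX]
  constructor
  -- The Laplacian of term i+1 is `b i - b (i + 1)`, so the sum telescopes. `b 0` vanishes by its
  -- factor i, which also makes the truncated exponent harmless, and `b k` vanishes because p_{k+1}
  -- = 0.
  · set b : ℕ → MvPolynomial (Fin m) ℂ := fun i =>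
      ((-2 : ℂ) ^ (i + 1) * ((i + 1) * i)) • Λ i (pairing m ^ (i - 1) * taylor p (i + 1)) with hb
    have hterm : ∀ i, polyLaplacian m ((-2 : ℂ) ^ (i + 1) •
        Λ (i + 1) (pairing m ^ (i + 1) * taylor p (i + 1))) = b i - b (i + 1) := by
      intro i
      have hL := laplacianU_taylor hp.1
      rw [map_smul, hlap]
      rcases i with _ | i
      · rw [zero_add, pow_one, pow_one, laplacianU_pairing_mul, hL, mul_zero, zero_add, xDu_taylor]
        simp only [hb]
        rw [show (2 : Poly₂ m) = algebraMap ℂ (Poly₂ m) 2 by rw [map_ofNat], ← Algebra.smul_def,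
          map_smul, map_smul]
        simp only [Nat.sub_self, zero_add, pow_zero, one_mul]
        push_cast
        module
      · rw [laplacianU_pairing_pow_mul i (hL _), map_add, map_smul, map_smul, hr, xDu_taylor,
          mul_smul_comm, map_smul]
        simp only [hb, Nat.add_sub_cancel]
        push_cast
        module
    rw [map_sum, Finset.sum_range_succ']
    simp only [hterm]
    rw [Finset.sum_range_sub', map_smul, hlap, pow_zero, pow_zero, one_mul, one_smul,
      laplacianU_taylor hp.1, map_zero, add_zero]
    simp [hb, taylor_eq_zero hp.2 (Nat.lt_succ_self k)]
  · rw [map_sum, Finset.smul_sum]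
    refine Finset.sum_congr rfl fun i _ => ?_
    have hpow : ∀ i : ℕ, eulerU m (pairing m ^ i) = (i : ℂ) • pairing m ^ i := by
      intro i
      induction i with
      | zero => simp [eulerU_apply]
      | succ i ih =>
        rw [pow_succ, eulerU_mul, ih, eulerU_pairing]
        simp only [Algebra.smul_def, map_natCast]
        push_cast
        ring
    rw [map_smul, heul, eulerU_mul, hpow, eulerU_taylor hp.2, smul_mul_assoc, mul_smul_comm,
      ← add_smul, sub_add_cancel, map_smul, smul_comm]

end Taylor

/-! ### Action of U, A and L on the two expansions. -/

section Expansion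

variable {m : ℕ}

lemma opU_powerDist (hm : 1 ≤ m) {a : ℝ} {d : ℕ} {Q : Poly₂ m} (hQ : IsWeightedHomogeneous wx Q d)
    (had : -(m : ℝ) < a + d - 1) :
    opU (powerDist a Q) = (a : ℂ) • powerDist (a - 2) (pairing m * Q) +
      powerDist a (∑ i, MvPolynomial.X (Sum.inr i) * pderiv (Sum.inl i) Q) := by
  funext φ
  rw [opU_apply, pairing, Finset.sum_mul, map_sum, map_sum, Pi.add_apply, Pi.smul_apply,
    Finset.sum_apply, Finset.sum_apply, Finset.smul_sum, ← Finset.sum_add_distrib]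
  refine Finset.sum_congr rfl fun i _ => ?_
  rw [dX_powerDist hm hQ had, Pi.add_apply, Pi.smul_apply, mul_add, mul_smul_comm,
    ← powerDist_X_inr_mul, ← powerDist_X_inr_mul, mul_left_comm, mul_assoc]

lemma opA_powerDist (hm : 1 ≤ m) {a : ℝ} {d : ℕ} {Q : Poly₂ m} (hQ : IsWeightedHomogeneous wx Q d)
    (had : -(m : ℝ) < a + d - 1) :
    opA (powerDist a Q) = (a : ℂ) • powerDist (a - 2) (xDu m Q) +
      powerDist a (∑ i, pderiv (Sum.inr i) (pderiv (Sum.inl i) Q)) := by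
  funext φ
  rw [opA_apply, xDu_apply, map_sum, map_sum, Pi.add_apply, Pi.smul_apply, Finset.sum_apply,
    Finset.sum_apply, Finset.smul_sum, ← Finset.sum_add_distrib]
  refine Finset.sum_congr rfl fun i _ => ?_
  rw [dX_powerDist hm hQ had, Pi.add_apply, Pi.smul_apply, map_add, Derivation.map_smul,
    ← powerDist_pderiv_inr, ← powerDist_pderiv_inr, pderiv_mul, pderiv_inr_X_inl, zero_mul,
    zero_add]

/-- For d = 0 the derivative is zero and has every degree. The real inequality is all that
integrability needs, and it avoids a truncated d - 1. -/
lemma exists_isWeightedHomogeneous_pderiv {d : ℕ} {Q : Poly₂ m}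
    (hQ : IsWeightedHomogeneous wx Q d) (i : Fin m) :
    ∃ d' : ℕ, (d : ℝ) - 1 ≤ d' ∧ IsWeightedHomogeneous wx (pderiv (Sum.inl i) Q) d' := by
  rcases d with _ | d
  · refine ⟨0, by simp, ?_⟩
    suffices h : pderiv (Sum.inl i) Q = 0 by rw [h]; exact isWeightedHomogeneous_zero ℂ wx 0
    ext γ
    rw [coeff_pderiv, coeff_zero]
    convert zero_mul _
    refine hQ.coeff_eq_zero _ ?_
    simp [Finsupp.weight_single, wx]
  · exact ⟨d, by simp, hQ.pderiv (by simp [wx])⟩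

lemma sum_inl_X_mul_pderiv {d : ℕ} {Q : Poly₂ m} (hQ : IsWeightedHomogeneous wx Q d) :
    ∑ i, MvPolynomial.X (Sum.inl i) * pderiv (Sum.inl i) Q = (d : ℂ) • Q := by
  have h := hQ.sum_weight_X_mul_pderiv
  rw [Fintype.sum_sum_type] at h
  simpa [wx, Algebra.smul_def] using h

/-- For Q harmonic in x: the terms x_i² rebuild ‖x‖², giving a(a-2); the derivatives of x_i give
a·m; and Euler's identity turns the cross terms into 2ad. -/
lemma opL_powerDist (hm : 1 ≤ m) {a : ℝ} {d : ℕ} {Q : Poly₂ m} (hQ : IsWeightedHomogeneous wx Q d)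
    (had : -(m : ℝ) < a + d - 2) (hQ0 : ∑ i, pderiv (Sum.inl i) (pderiv (Sum.inl i) Q) = 0) :
    opL (powerDist a Q) = ((a * (a - 2 + m + 2 * d) : ℝ) : ℂ) • powerDist (a - 2) Q := by
  have hterm : ∀ i : Fin m, dX i (dX i (powerDist a Q)) =
      (a * (a - 2) : ℂ) • powerDist (a - 2 - 2)
        (MvPolynomial.X (Sum.inl i) * MvPolynomial.X (Sum.inl i) * Q) +
      (a : ℂ) • powerDist (a - 2) Q +
      (2 * a : ℂ) • powerDist (a - 2) (MvPolynomial.X (Sum.inl i) * pderiv (Sum.inl i) Q) +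
      powerDist a (pderiv (Sum.inl i) (pderiv (Sum.inl i) Q)) := by
    intro i
    obtain ⟨d', hd', hQ'⟩ := exists_isWeightedHomogeneous_pderiv hQ i
    have hXQ : IsWeightedHomogeneous wx (MvPolynomial.X (Sum.inl i) * Q) (1 + d) :=
      (isWeightedHomogeneous_X ℂ wx (Sum.inl i)).mul hQ
    rw [dX_powerDist hm hQ (by linarith), map_add, map_smul,
      dX_powerDist hm hXQ (by push_cast; linarith), dX_powerDist hm hQ' (by linarith),
      pderiv_mul, pderiv_X_self, one_mul, map_add, mul_assoc]
    push_cast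
    module
  rw [opL, LinearMap.sum_apply]
  simp only [Module.End.mul_apply, hterm, Finset.sum_add_distrib, ← Finset.smul_sum, ← map_sum,
    ← Finset.sum_mul]
  have h1 : (∑ i : Fin m, MvPolynomial.X (Sum.inl i) * MvPolynomial.X (Sum.inl i) : Poly₂ m) =
    xNormSq m := rfl
  rw [sum_inl_X_mul_pderiv hQ, hQ0, h1, powerDist_xNormSq_mul hm hQ (by linarith), map_zero,
    add_zero, map_smul, sub_add_cancel, Finset.sum_const, Finset.card_univ, Fintype.card_fin,
    ← Nat.cast_smul_eq_nsmul ℂ, map_smul]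
  push_cast
  module

variable (m) in
/-- The exponent `4 - m`. -/
abbrev expo : ℝ := 4 - m

/-- The distributions `‖x‖^{4 - m} p_j(x, u)`. -/
def taylorDist (p : MvPolynomial (Fin m) ℂ) (j : ℕ) : PolyDist m := powerDist (expo m) (taylor p j)

lemma sum_pderiv_inr_inl_taylor {p : MvPolynomial (Fin m) ℂ} (hp : polyLaplacian m p = 0) (j : ℕ) :
    ∑ i, pderiv (Sum.inr i) (pderiv (Sum.inl i) (taylor p j)) = 0 := by
  rcases j with _ | j
  · simp [pderiv_inl_taylor_zero]
  · simp only [pderiv_inl_taylor_succ]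
    rw [← laplacianU_apply, laplacianU_taylor hp]

lemma sum_pderiv_inl_inl_taylor {p : MvPolynomial (Fin m) ℂ} (hp : polyLaplacian m p = 0) (j : ℕ) :
    ∑ i, pderiv (Sum.inl i) (pderiv (Sum.inl i) (taylor p j)) = 0 := by
  rcases j with _ | j
  · simp [pderiv_inl_taylor_zero]
  · simp only [pderiv_inl_taylor_succ, pderiv_comm (Sum.inl _) (Sum.inr _)]
    exact sum_pderiv_inr_inl_taylor hp j

/-- Both sides are multiples of ‖x‖^{2-m} p_{j+1}: A gives the factor (4-m)(j+1) and L gives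
(4-m)(2j+4). -/
lemma opA_taylorDist (hm : 1 ≤ m) {p : MvPolynomial (Fin m) ℂ} (hp : polyLaplacian m p = 0)
    (j : ℕ) :
    opA (taylorDist p j) = (((j : ℂ) + 1) / (2 * (j + 2))) • opL (taylorDist p (j + 1)) := by
  have hj : (j : ℝ) ≥ 0 := j.cast_nonneg
  rw [taylorDist, taylorDist, opA_powerDist hm (isWeightedHomogeneous_taylor p j)
    (by simp only [expo]; linarith), sum_pderiv_inr_inl_taylor hp, map_zero, add_zero,
    opL_powerDist hm (isWeightedHomogeneous_taylor p (j + 1))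
    (by simp only [expo]; push_cast; linarith) (sum_pderiv_inl_inl_taylor hp _), xDu_taylor,
    map_smul, smul_smul, smul_smul]
  congr 1
  have hj2 : (j : ℂ) + 2 ≠ 0 := by exact_mod_cast (by omega : j + 2 ≠ 0)
  simp only [expo]
  push_cast
  field_simp
  ring

/-- The classical Δ‖x‖^{2-m} = (2-m)|S^{m-1}| δ. The first derivative is still locally integrable;
the second is taken weakly through the flux identity. -/
lemma opL_powerDist_fundamental (hm : 2 ≤ m) (p : MvPolynomial (Fin m) ℂ) (φ : Test m) :
    opL (powerDist (2 - m) (taylor p 0)) φ =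
      (((2 - m) * (volume : Measure (X m)).toSphere.real Set.univ * φ 0 : ℝ) : ℂ) • p := by
  have h2 : ∀ (i : Fin m) (ψ : Test m),
      powerDist (-m) (MvPolynomial.X (Sum.inl i) * taylor p 0) ψ =
        ((∫ x, ψ x * (‖x‖ ^ (-(m : ℝ)) * x i) : ℝ) : ℂ) • p := by
    intro i ψ
    rw [taylor]
    induction p using MvPolynomial.induction_on' with
    | monomial α c =>
      rw [rename_monomial, X_mul_monomial', powerDist_monomial, smul_monomial, xPart_single_inl_add,
        uPart_single_inl_add]
      have hx : xPart (Finsupp.mapDomain (Sum.inr : Fin m → Fin m ⊕ Fin m) α) = 0 := by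
        ext j
        simp only [xPart, Finsupp.comapDomain_apply]
        exact Finsupp.mapDomain_of_notMem_range _ _ (by simp)
      have hu : uPart (Finsupp.mapDomain (Sum.inr : Fin m → Fin m ⊕ Fin m) α) = α := by
        ext j
        simp only [uPart, Finsupp.comapDomain_apply]
        exact Finsupp.mapDomain_apply Sum.inr_injective _ _
      rw [hx, hu, smul_eq_mul, mul_comm]
      congr 3
      refine integral_congr_ae (.of_forall fun x => ?_)
      simp only [monoFun_single_add]
      simp [monoFun]
    | add p q hp hq => rw [map_add, mul_add, map_add, Pi.add_apply, hp, hq, smul_add]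
  have h1 : ∀ i : Fin m, dX i (powerDist (2 - m) (taylor p 0)) =
      ((2 - m : ℝ) : ℂ) • powerDist (-m) (MvPolynomial.X (Sum.inl i) * taylor p 0) := by
    intro i
    rw [dX_powerDist (by omega) (isWeightedHomogeneous_taylor p 0) (by push_cast; linarith),
      pderiv_inl_taylor_zero, map_zero, add_zero]
    congr 2
    ring_nf
  have h3 := integral_radialDeriv hm φ
  rw [opL_apply]
  simp only [h1, Pi.smul_apply, dX_apply, h2]
  rw [Finset.sum_neg_distrib, ← Finset.smul_sum, ← Finset.sum_smul, ← Complex.ofReal_sum, h3,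
    ← neg_smul, smul_smul]
  congr 1
  push_cast
  ring

lemma opL_opL_taylorDist_zero (hm : 2 ≤ m) (p : MvPolynomial (Fin m) ℂ) (φ : Test m) :
    opL (opL (taylorDist p 0)) φ =
      ((2 * (4 - m) * (2 - m) * (volume : Measure (X m)).toSphere.real Set.univ * φ 0 : ℝ) : ℂ) •
        p := by
  rw [taylorDist, opL_powerDist (by omega) (isWeightedHomogeneous_taylor p 0)
    (by simp only [expo]; push_cast; linarith) (by simp [pderiv_inl_taylor_zero]), map_smul,
    Pi.smul_apply, show expo m - 2 = 2 - m by simp only [expo]; ring, opL_powerDist_fundamental hm,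
    smul_smul]
  congr 1
  simp only [expo]
  push_cast
  ring

/-- The distributions `∑_{i ≤ K} (-2)^i ‖x‖^{4 - m - 2 i} ⟨x, u⟩^i p_{i + j}(x, u)`. -/
def reflectionDist (p : MvPolynomial (Fin m) ℂ) (j K : ℕ) : PolyDist m :=
  ∑ i ∈ Finset.range (K + 1),
    (-2 : ℂ) ^ i • powerDist (expo m - 2 * i) (pairing m ^ i * taylor p (i + j))

/-- ⟨u,D_x⟩ applied to ⟨x,u⟩ gives ‖u‖², which goes into Q. Applied to p_{d+1} it gives the u-Euler
operator on p_d, with eigenvalue k - d. -/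
lemma sum_inr_X_mul_pderiv_inl {p : MvPolynomial (Fin m) ℂ} {k : ℕ}
    (hp : euler m p = (k : ℂ) • p) (i d : ℕ) :
    ∃ Q : Poly₂ m, ∑ a, MvPolynomial.X (Sum.inr a) * pderiv (Sum.inl a)
        (pairing m ^ i * taylor p (d + 1)) =
      ((k : ℂ) - d) • (pairing m ^ i * taylor p d) +
        (∑ a, MvPolynomial.X (Sum.inr a) * MvPolynomial.X (Sum.inr a)) * Q := by
  refine ⟨i • (pairing m ^ (i - 1) * taylor p (d + 1)), ?_⟩
  have h := eulerU_taylor hp d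
  rw [eulerU_apply] at h
  rw [← mul_smul_comm, ← h, Finset.mul_sum, Finset.sum_mul, ← Finset.sum_add_distrib]
  refine Finset.sum_congr rfl fun a _ => ?_
  rw [pderiv_mul, pderiv_pow, pderiv_inl_pairing, pderiv_inl_taylor_succ, nsmul_eq_mul]
  ring

lemma powerDist_normSq_mul (a : ℝ) (Q : Poly₂ m) (φ : Test m) :
    powerDist a ((∑ i, MvPolynomial.X (Sum.inr i) * MvPolynomial.X (Sum.inr i)) * Q) φ =
      normSq m * powerDist a Q φ := by
  rw [Finset.sum_mul, map_sum, Finset.sum_apply, normSq, Finset.sum_mul]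
  refine Finset.sum_congr rfl fun i _ => ?_
  rw [mul_assoc, powerDist_X_inr_mul, powerDist_X_inr_mul, mul_assoc]

/-- Congruence modulo `‖u‖²` of polynomial-valued distributions. -/
def CongrMod (S T : PolyDist m) : Prop := ∀ φ, normSq m ∣ S φ - T φ

lemma CongrMod.rfl {S : PolyDist m} : CongrMod S S := fun φ => by simp

lemma CongrMod.symm {S T : PolyDist m} (h : CongrMod S T) : CongrMod T S := fun φ => by
  rw [← neg_sub]; exact (h φ).neg_right

lemma CongrMod.trans {S T V : PolyDist m} (h : CongrMod S T) (h' : CongrMod T V) :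
    CongrMod S V := fun φ => by
  simpa using (h φ).add (h' φ)

lemma CongrMod.add {S T S' T' : PolyDist m} (h : CongrMod S T) (h' : CongrMod S' T') :
    CongrMod (S + S') (T + T') := fun φ => by
  rw [Pi.add_apply, Pi.add_apply, add_sub_add_comm]; exact (h φ).add (h' φ)

lemma CongrMod.smul {S T : PolyDist m} (h : CongrMod S T) (c : ℂ) :
    CongrMod (c • S) (c • T) := fun φ => by
  rw [Pi.smul_apply, Pi.smul_apply, ← smul_sub]
  obtain ⟨q, hq⟩ := h φ
  exact ⟨c • q, by rw [hq, mul_smul_comm]⟩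

lemma CongrMod.sum {ι : Type*} {s : Finset ι} {S T : ι → PolyDist m}
    (h : ∀ i ∈ s, CongrMod (S i) (T i)) : CongrMod (∑ i ∈ s, S i) (∑ i ∈ s, T i) := fun φ => by
  rw [Finset.sum_apply, Finset.sum_apply, ← Finset.sum_sub_distrib]
  exact Finset.dvd_sum fun i hi => h i hi φ

lemma CongrMod.opU {S T : PolyDist m} (h : CongrMod S T) :
    CongrMod (HigherSpin.opU S) (HigherSpin.opU T) := fun φ => by
  rw [opU_apply, opU_apply, ← Finset.sum_sub_distrib]
  refine Finset.dvd_sum fun i _ => ?_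
  rw [← mul_sub, dX_apply, dX_apply, ← neg_sub_neg, neg_neg, neg_neg]
  exact (h.symm _).mul_left _

lemma congrMod_twistorOp (w : ℂ) (T : PolyDist m) :
    CongrMod (twistorOp opA opU opρ w T) (opU T) := fun φ => by
  have : twistorOp opA opU opρ w T φ - opU T φ =
      normSq m * (-((1 / (2 * w)) • opA T φ)) := by
    simp [twistorOp, opρ_apply]
  exact ⟨_, this⟩

lemma congrMod_opU_term (hm : 1 ≤ m) {p : MvPolynomial (Fin m) ℂ} {k : ℕ}
    (hp : euler m p = (k : ℂ) • p) (i j : ℕ) :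
    CongrMod (opU (powerDist (expo m - 2 * i) (pairing m ^ i * taylor p (i + (j + 1)))))
      (((expo m - 2 * i : ℝ) : ℂ) • powerDist (expo m - 2 * (i + 1 : ℕ))
          (pairing m ^ (i + 1) * taylor p (i + 1 + j)) +
        ((k : ℂ) - (i + j)) • powerDist (expo m - 2 * i) (pairing m ^ i * taylor p (i + j))) := by
  intro φ
  have hj : (j : ℝ) ≥ 0 := j.cast_nonneg
  rw [opU_powerDist hm (isWeightedHomogeneous_pairing_pow_mul (isWeightedHomogeneous_taylor p _) i)
    (by simp only [expo]; push_cast; linarith)]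
  obtain ⟨Q, hQ⟩ := sum_inr_X_mul_pderiv_inl hp i (i + j)
  rw [show i + (j + 1) = i + j + 1 by ring, hQ, map_add, map_smul,
    show expo m - 2 * (i + 1 : ℕ) = expo m - 2 * i - 2 by push_cast; ring,
    show i + 1 + j = i + j + 1 by ring, pow_succ', mul_assoc]
  refine ⟨powerDist (expo m - 2 * i) Q φ, ?_⟩
  rw [← powerDist_normSq_mul]
  simp only [Pi.add_apply]
  push_cast
  ring

/-- With σ = (m-4)/2 and R for the reflection sums, this reads (1-σ) F_j + (σ+K) R_{j,K+1} ≡ U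
R_{j+1,K} modulo ‖u‖². It is the recursion that `twistorSum` copies. -/
lemma congrMod_reflectionDist_succ (hm : 1 ≤ m) {p : MvPolynomial (Fin m) ℂ} {k j K : ℕ}
    (hp : euler m p = (k : ℂ) • p) (hk : k = j + (K + 1)) :
    CongrMod (((expo m / 2 : ℝ) : ℂ) • taylorDist p j + taylorDist p j +
        (-((expo m / 2 : ℝ) : ℂ) + K) • reflectionDist p j (K + 1))
      (opU (reflectionDist p (j + 1) K)) := by
  have h : CongrMod (opU (reflectionDist p (j + 1) K))
      (∑ i ∈ Finset.range (K + 1), (-2 : ℂ) ^ i • (((expo m - 2 * i : ℝ) : ℂ) •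
        powerDist (expo m - 2 * (i + 1 : ℕ)) (pairing m ^ (i + 1) * taylor p (i + 1 + j)) +
        ((k : ℂ) - (i + j)) • powerDist (expo m - 2 * i) (pairing m ^ i * taylor p (i + j)))) := by
    rw [reflectionDist, map_sum]
    refine CongrMod.sum fun i _ => ?_
    rw [map_smul]
    exact (congrMod_opU_term hm hp i j).smul _
  refine CongrMod.trans ?_ h.symm
  set w : ℕ → PolyDist m := fun i =>
    powerDist (expo m - 2 * i) (pairing m ^ i * taylor p (i + j)) with hw
  have h0 : taylorDist p j = w 0 := by simp [hw, taylorDist]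
  have hR : reflectionDist p j (K + 1) = ∑ i ∈ Finset.range (K + 2), (-2 : ℂ) ^ i • w i := rfl
  set s : ℂ := ((expo m / 2 : ℝ) : ℂ) with hs
  have hs2 : ∀ i : ℕ, ((expo m - 2 * i : ℝ) : ℂ) = 2 * (s - i) := by
    intro i; simp only [hs]; push_cast; ring
  -- The second sum may run one index further because its coefficient K + 1 - i vanishes at i = K +
  -- 1.
  have e1 : ∑ i ∈ Finset.range (K + 1), (-2 : ℂ) ^ i • (((expo m - 2 * i : ℝ) : ℂ) • w (i + 1) +
      ((k : ℂ) - (i + j)) • w i) =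
      ∑ i ∈ Finset.range (K + 1), ((-2 : ℂ) ^ (i + 1) * (i - s)) • w (i + 1) +
      ∑ i ∈ Finset.range (K + 2), ((-2 : ℂ) ^ i * ((K : ℂ) + 1 - i)) • w i := by
    rw [Finset.sum_range_succ (fun i => ((-2 : ℂ) ^ i * ((K : ℂ) + 1 - i)) • w i),
      ← add_assoc, ← Finset.sum_add_distrib]
    have : ((-2 : ℂ) ^ (K + 1) * ((K : ℂ) + 1 - (K + 1 : ℕ))) • w (K + 1) = 0 := by
      push_cast; simp
    rw [this, add_zero]
    refine Finset.sum_congr rfl fun i _ => ?_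
    rw [hs2, hk]
    push_cast
    module
  -- After reindexing, the missing term i = 0 has coefficient -(s+1). Restoring it produces the
  -- correction (s+1) F_j.
  have e2 : ∑ i ∈ Finset.range (K + 1), ((-2 : ℂ) ^ (i + 1) * (i - s)) • w (i + 1) =
      ∑ i ∈ Finset.range (K + 2), ((-2 : ℂ) ^ i * (i - 1 - s)) • w i + (s + 1) • w 0 := by
    rw [Finset.sum_range_succ' (fun i => ((-2 : ℂ) ^ i * (i - 1 - s)) • w i), add_assoc, ← add_smul]
    push_cast
    simp only [pow_zero, add_sub_cancel_right]
    module
  have e3 : s • taylorDist p j + taylorDist p j + (-s + K) • reflectionDist p j (K + 1) =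
      ∑ i ∈ Finset.range (K + 1), (-2 : ℂ) ^ i • (((expo m - 2 * i : ℝ) : ℂ) • w (i + 1) +
      ((k : ℂ) - (i + j)) • w i) := by
    have e4 : ∑ i ∈ Finset.range (K + 2), ((-2 : ℂ) ^ i * (i - 1 - s)) • w i +
        ∑ i ∈ Finset.range (K + 2), ((-2 : ℂ) ^ i * ((K : ℂ) + 1 - i)) • w i =
        (-s + K) • ∑ i ∈ Finset.range (K + 2), (-2 : ℂ) ^ i • w i := by
      rw [← Finset.sum_add_distrib, Finset.smul_sum]
      exact Finset.sum_congr rfl fun i _ => by module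
    rw [e1, e2, hR, h0, add_right_comm _ _ (∑ i ∈ Finset.range (K + 2), ((-2 : ℂ) ^ i * ((K : ℂ) + 1 - i)) • w i), e4]
    module
  rw [e3]
  exact CongrMod.rfl

end Expansion

/-! ### Equality of the two expansions and the constant of D₄. -/

section FundamentalSolution

variable {m : ℕ}

variable (m) in
/-- The parameter `(m - 4) / 2`. -/
abbrev para : ℂ := ((m : ℂ) - 4) / 2

lemma para_add_ne_zero (hm : 3 ≤ m) (hm4 : m ≠ 4) (i : ℕ) : para m + i ≠ 0 := by
  have h : (m + 2 * i : ℕ) ≠ 4 := by omega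
  have h2 : ((m + 2 * i : ℕ) : ℂ) ≠ (4 : ℕ) := by exact_mod_cast h
  intro h3
  apply h2
  simp only [para] at h3
  push_cast
  linear_combination 2 * h3

/-- The rising factorials of `(m - 4) / 2 - 1`. -/
abbrev coeffTerm (m n : ℕ) : ℂ := (ascPochhammer ℂ n).eval (para m - 1)

/-- The rising factorials of `(m - 4) / 2`. -/
abbrev coeffSum (m n : ℕ) : ℂ := (ascPochhammer ℂ n).eval (para m)

lemma coeffTerm_succ' (n : ℕ) : coeffTerm m (n + 1) = (para m - 1) * coeffSum m n := by
  simp [coeffTerm, coeffSum, ascPochhammer_succ_left]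

/-- The harmonic representatives of the distributions `reflectionDist`. -/
def twistorSum (p : MvPolynomial (Fin m) ℂ) : ℕ → ℕ → PolyDist m
  | 0, j => taylorDist p j
  | K + 1, j => coeffTerm m (K + 1) • taylorDist p j +
      twistorOp opA opU opρ (para m + K + 1) (twistorSum p K (j + 1))

lemma twistorSum_eq (p : MvPolynomial (Fin m) ℂ) (K j : ℕ) :
    twistorSum p K j = ∑ i ∈ Finset.range (K + 1),
      coeffTerm m (K - i) • twistorChain opA opU opρ (para m + K - i) i (taylorDist p (j + i)) := by
  induction K generalizing j with
  | zero => simp [twistorSum, twistorChain, coeffTerm]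
  | succ K ih =>
    rw [twistorSum, ih, Finset.sum_range_succ' _ (K + 1), add_comm, map_sum]
    congr 1
    · refine Finset.sum_congr rfl fun i _ => ?_
      rw [map_smul, twistorChain, Module.End.mul_apply]
      have e1 : para m + (K + 1 : ℕ) - (i + 1 : ℕ) = para m + K - i := by push_cast; ring
      have e2 : para m + K - i + i + 1 = para m + K + 1 := by ring
      rw [e1, e2, Nat.add_sub_add_right, show j + 1 + i = j + (i + 1) by ring]

lemma isHarmonicOfDegree_taylorDist {p : MvPolynomial (Fin m) ℂ} {k : ℕ}
    (hp : IsHarmonicOfDegree k p) {j K : ℕ} (hk : k = j + K) (φ : Test m) :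
    IsHarmonicOfDegree K (taylorDist p j φ) := by
  constructor
  · rw [polyLaplacian_apply, taylorDist]
    simp only [← powerDist_pderiv_inr]
    rw [← Finset.sum_apply, ← map_sum, ← laplacianU_apply, laplacianU_taylor hp.1, map_zero,
      Pi.zero_apply]
  · rw [euler_apply, taylorDist]
    simp only [← powerDist_pderiv_inr, ← powerDist_X_inr_mul]
    rw [← Finset.sum_apply, ← map_sum, ← eulerU_apply, eulerU_taylor hp.2, map_smul, Pi.smul_apply,
      hk]
    push_cast
    rw [add_sub_cancel_left]

lemma isHarmonicOfDegree_twistorSum (hm : 3 ≤ m) (hm4 : m ≠ 4) {p : MvPolynomial (Fin m) ℂ} {k : ℕ}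
    (hp : IsHarmonicOfDegree k p) (K : ℕ) {j : ℕ} (hk : k = j + K) (φ : Test m) :
    IsHarmonicOfDegree K (twistorSum p K j φ) := by
  induction K generalizing j φ with
  | zero => exact isHarmonicOfDegree_taylorDist hp hk φ
  | succ K ih =>
    rw [twistorSum]
    refine IsHarmonicOfDegree.add ((isHarmonicOfDegree_taylorDist hp hk φ).smul _) ?_
    have h := para_add_ne_zero hm hm4 (K + 1)
    push_cast at h ⊢
    rw [← add_assoc] at h
    exact isHarmonicOfDegree_twistorOp (by simp only [para]; ring) h
      (fun ψ => ih (by omega) ψ) φ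

/-- Multiplying the recursion of `congrMod_reflectionDist_succ` by (σ)_K, where σ = (m-4)/2, turns σ
+ K into (σ)_{K+1} and σ - 1 into (σ-1)_{K+1}. These are `coeffSum` and `coeffTerm`. -/
lemma congrMod_twistorSum (hm : 1 ≤ m) {p : MvPolynomial (Fin m) ℂ} {k : ℕ}
    (hp : euler m p = (k : ℂ) • p) (K : ℕ) {j : ℕ} (hk : k = j + K) :
    CongrMod (coeffSum m K • reflectionDist p j K) (twistorSum p K j) := by
  induction K generalizing j with
  | zero =>
    have : coeffSum m 0 • reflectionDist p j 0 = twistorSum p 0 j := by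
      simp [twistorSum, reflectionDist, taylorDist, coeffSum]
    rw [this]
    exact CongrMod.rfl
  | succ K ih =>
    have h1 := (congrMod_reflectionDist_succ hm hp hk).smul (coeffSum m K)
    have h2 := ((ih (j := j + 1) (by omega)).opU).trans
      (congrMod_twistorOp (para m + K + 1) _).symm
    rw [map_smul] at h2
    have h3 := (CongrMod.rfl (S := coeffTerm m (K + 1) • taylorDist p j)).add (h1.trans h2)
    have h4 : coeffSum m (K + 1) • reflectionDist p j (K + 1) =
        coeffTerm m (K + 1) • taylorDist p j + coeffSum m K •
          (((expo m / 2 : ℝ) : ℂ) • taylorDist p j + taylorDist p j +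
            (-((expo m / 2 : ℝ) : ℂ) + K) • reflectionDist p j (K + 1)) := by
      rw [coeffTerm_succ', coeffSum, ascPochhammer_succ_eval]
      have : ((expo m / 2 : ℝ) : ℂ) = -para m := by simp only [expo, para]; push_cast; ring
      rw [this]
      module
    rw [h4]
    exact h3

/-- Tested against φ, the difference is harmonic of degree k and divisible by ‖u‖², hence zero. -/
theorem smul_reflectionDist_eq (hm : 3 ≤ m) (hm4 : m ≠ 4) {p : MvPolynomial (Fin m) ℂ} {k : ℕ}
    (hp : IsHarmonicOfDegree k p) :
    coeffSum m k • reflectionDist p 0 k = twistorSum p k 0 := by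
  funext φ
  have hR : IsHarmonicOfDegree k (reflectionDist p 0 k φ) := by
    -- Here the functional of index n is integration against φ ‖x‖^{4-m-2n}.
    have h := isHarmonicOfDegree_reflection hp
      (fun n => LinearMap.proj (φ := fun _ => MvPolynomial (Fin m) ℂ) φ ∘ₗ
        powerDist (expo m - 2 * n))
      (fun n i Q => powerDist_X_inr_mul _ i Q φ) (fun n i Q => powerDist_pderiv_inr _ i Q φ)
      (fun i => by
        simp only [LinearMap.comp_apply, LinearMap.proj_apply]
        rw [powerDist_xNormSq_mul (by omega) (isWeightedHomogeneous_pairing_pow_mul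
          (isWeightedHomogeneous_taylor p _) i) (by simp only [expo]; push_cast; linarith)]
        rw [show expo m - 2 * ((i + 2 : ℕ) : ℝ) + 2 = expo m - 2 * ((i + 1 : ℕ) : ℝ) by
          push_cast; ring])
    simpa [reflectionDist] using h
  have h1 := (hR.smul (coeffSum m k)).add
    (isHarmonicOfDegree_twistorSum hm hm4 hp k (zero_add k).symm φ).neg
  have h2 := congrMod_twistorSum (by omega) hp.2 k (zero_add k).symm φ
  rw [sub_eq_add_neg] at h2
  have h3 := h1.eq_zero_of_dvd (by omega) h2
  exact add_neg_eq_zero.1 h3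

/-- The operator `D₄` on polynomial-valued distributions. -/
def opD₄ (k : ℕ) (T : PolyDist m) : PolyDist m :=
  opD₂ opA opU opρ opL (para m + k) (opD₂ opA opU opρ opL (para m + k) T) -
    (2 / ((para m + k) * (para m + k + 1))) • opD₂ opA opU opρ opL (para m + k) (opL T)

variable (m) in
/-- The constant `D₄ (‖x‖^{4 - m} p(x u x / ‖x‖²)) / (δ(x) p(u))`. -/
def fundamentalConst (k : ℕ) : ℝ :=
  (ascPochhammer ℝ k).eval (((m : ℝ) - 4) / 2 - 1) / (ascPochhammer ℝ k).eval (((m : ℝ) - 4) / 2) *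
    (1 - 2 / ((((m : ℝ) - 4) / 2 + k) * (((m : ℝ) - 4) / 2 + k + 1))) *
    (2 * (4 - m) * (2 - m) * (volume : Measure (X m)).toSphere.real Set.univ)

lemma ofReal_ascPochhammer_eval (n : ℕ) (r : ℝ) :
    (((ascPochhammer ℝ n).eval r : ℝ) : ℂ) = (ascPochhammer ℂ n).eval (r : ℂ) := by
  induction n with
  | zero => simp
  | succ n ih => rw [ascPochhammer_succ_eval, ascPochhammer_succ_eval, ← ih]; push_cast; rfl

theorem opD₄_reflectionDist (hm : 3 ≤ m) (hm4 : m ≠ 4) {p : MvPolynomial (Fin m) ℂ} {k : ℕ}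
    (hp : IsHarmonicOfDegree k p) (φ : Test m) :
    opD₄ k (reflectionDist p 0 k) φ = ((fundamentalConst m k * φ 0 : ℝ) : ℂ) • p := by
  have hσ := para_add_ne_zero hm hm4
  -- Needed to divide the identity of `smul_reflectionDist_eq` by its factor; m ≠ 4 enters here.
  have hb : coeffSum m k ≠ 0 := by
    rw [coeffSum, ne_eq, ascPochhammer_eval_eq_zero_iff]
    rintro ⟨i, -, hi⟩
    exact hσ i (by rw [hi]; ring)
  have h1 := opD₂_opD₂_sum (A := opA (m := m)) opA_mul_opU opA_mul_opρ commute_opL_opA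
    commute_opL_opU commute_opL_opρ hσ k (F := taylorDist p)
    (by rw [taylorDist, taylor_eq_zero hp.2 (Nat.lt_succ_self k), map_zero])
    (opA_taylorDist (by omega) hp.1) (c := coeffTerm m)
    (fun n => ascPochhammer_succ_eval n (para m - 1))
  have h2 := twistorSum_eq p k 0
  simp only [zero_add] at h2
  rw [← h2, ← smul_reflectionDist_eq hm hm4 hp] at h1
  simp only [map_smul, LinearMap.sub_apply, LinearMap.smul_apply, map_sub] at h1
  have h3 : coeffSum m k • opD₄ k (reflectionDist p 0 k) = _ := h1
  have h4 := congrFun h3 φ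
  rw [Pi.smul_apply, Pi.smul_apply, opL_opL_taylorDist_zero (by omega), smul_smul] at h4
  rw [← inv_smul_smul₀ hb (opD₄ k (reflectionDist p 0 k) φ), h4, smul_smul]
  congr 1
  have e1 : (((ascPochhammer ℝ k).eval (((m : ℝ) - 4) / 2 - 1) : ℝ) : ℂ) = coeffTerm m k := by
    rw [ofReal_ascPochhammer_eval, coeffTerm, para]; push_cast; rfl
  have e2 : (((ascPochhammer ℝ k).eval (((m : ℝ) - 4) / 2) : ℝ) : ℂ) = coeffSum m k := by
    rw [ofReal_ascPochhammer_eval, coeffSum, para]; push_cast; rfl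
  simp only [fundamentalConst, Complex.ofReal_mul, Complex.ofReal_div, e1, e2]
  simp only [para]
  push_cast
  ring

/-- Each linear factor vanishes only if m + 2i is 0, 2, 4 or 6 for some i ≥ 0; with m ≥ 3 that
leaves only m = 4 and m = 6. -/
lemma fundamentalConst_ne_zero (hm : 3 ≤ m) (hm4 : m ≠ 4) (hm6 : m ≠ 6) (k : ℕ) :
    fundamentalConst m k ≠ 0 := by
  have key : ∀ a : ℤ, (∀ i : ℕ, (m : ℤ) + 2 * i ≠ a) → ∀ i : ℕ, ((m : ℝ) - a) / 2 + i ≠ 0 := by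
    intro a ha i h
    apply ha i
    have : ((m : ℝ) + 2 * i) = a := by linarith
    exact_mod_cast this
  have h4 := key 4 (fun i => by omega)
  have h6 := key 6 (fun i => by omega)
  have h2 := key 2 (fun i => by omega)
  have h0 := key 0 (fun i => by omega)
  push_cast at h4 h6 h2 h0
  have hne : Nonempty (Fin m) := ⟨⟨0, by omega⟩⟩
  rw [fundamentalConst]
  refine mul_ne_zero (mul_ne_zero (div_ne_zero ?_ ?_) ?_) (mul_ne_zero (mul_ne_zero ?_ ?_) ?_)
  · rw [ne_eq, ascPochhammer_eval_eq_zero_iff]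
    rintro ⟨i, -, hi⟩
    exact h6 i (by rw [hi]; ring)
  · rw [ne_eq, ascPochhammer_eval_eq_zero_iff]
    rintro ⟨i, -, hi⟩
    exact h4 i (by rw [hi]; ring)
  · have ha := h4 k
    have hb : ((m : ℝ) - 4) / 2 + k + 1 ≠ 0 := by
      have := h2 k
      intro h
      apply this
      linarith
    rw [one_sub_div (mul_ne_zero ha hb)]
    refine div_ne_zero ?_ (mul_ne_zero ha hb)
    -- This is y(y+1) - 2 = (y-1)(y+2) for y = (m-4)/2 + k.
    have e : (((m : ℝ) - 4) / 2 + k) * (((m : ℝ) - 4) / 2 + k + 1) - 2 =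
        (((m : ℝ) - 6) / 2 + k) * (((m : ℝ) - 0) / 2 + k) := by ring
    rw [e]
    exact mul_ne_zero (h6 k) (h0 k)
  · have := h4 0
    intro h
    apply this
    push_cast
    linarith
  · have := h2 0
    intro h
    apply this
    push_cast
    linarith
  · rw [Measure.toSphere_real_apply_univ]
    have h1 : (0 : ℝ) < (volume : Measure (X m)).real (Metric.ball 0 1) :=
      ENNReal.toReal_pos (Metric.measure_ball_pos _ _ one_pos).ne' measure_ball_lt_top.ne
    simp only [finrank_euclideanSpace, Fintype.card_fin]
    exact mul_ne_zero (by positivity) h1.ne'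

end FundamentalSolution

/-! ### From polynomial-valued to function-valued distributions. -/

section Transfer

variable {m : ℕ}

/-- The distribution with values in functions of `u` given by a polynomial-valued distribution. -/
def toFunDist (T : PolyDist m) : Test m → X m → ℂ := fun φ => polyFun m (T φ)

lemma polyFun_apply (p : MvPolynomial (Fin m) ℂ) (u : X m) :
    polyFun m p u = aeval (fun i => ((u i : ℝ) : ℂ)) p := rfl

lemma fderiv_polyFun (p : MvPolynomial (Fin m) ℂ) (u : X m) (i : Fin m) :
    fderiv ℝ (polyFun m p) u (e i) = polyFun m (pderiv i p) u :=
  fderiv_aeval (𝕜 := ℂ) p u i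

lemma distPartialX_toFunDist (i : Fin m) (T : PolyDist m) :
    distPartialX i (toFunDist T) = toFunDist (dX i T) := by
  funext φ u
  simp [distPartialX, toFunDist, dX_apply]

lemma laplacianX_toFunDist (T : PolyDist m) :
    laplacianX distPartialX (toFunDist T) = toFunDist (opL T) := by
  funext φ u
  simp only [laplacianX, distPartialX_toFunDist, Finset.sum_apply]
  simp [toFunDist, opL_apply]

lemma uDx_toFunDist (T : PolyDist m) :
    uDx distPartialX (toFunDist T) = toFunDist (opU T) := by
  funext φ u
  simp only [uDx, distPartialX_toFunDist]
  simp [toFunDist, opU_apply, polyFun_apply]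

lemma DuDx_toFunDist (T : PolyDist m) :
    DuDx distPartialX (toFunDist T) = toFunDist (opA T) := by
  funext φ u
  simp only [DuDx, distPartialX_toFunDist]
  simp [toFunDist, opA_apply, fderiv_polyFun]

lemma polyFun_normSq (u : X m) : polyFun m (normSq m) u = ((‖u‖ : ℝ) : ℂ) ^ 2 := by
  rw [← Complex.ofReal_pow, EuclideanSpace.real_norm_sq_eq]
  simp [polyFun_apply, normSq, pow_two]

lemma twistor_toFunDist (k : ℕ) (T : PolyDist m) :
    twistor k distPartialX (toFunDist T) =
      toFunDist (twistorOp opA opU opρ (para m + k) T) := by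
  funext φ u
  have h : twistorOp opA opU opρ (para m + k) T φ =
      opU T φ - (1 / ((m : ℂ) + 2 * k - 4)) • (normSq m * opA T φ) := by
    have : (2 * (para m + k)) = (m : ℂ) + 2 * k - 4 := by simp only [para]; ring
    simp [twistorOp, opρ_apply, this]
  simp only [twistor, uDx_toFunDist, DuDx_toFunDist]
  simp only [toFunDist, h, map_sub, map_smul, Pi.sub_apply, Pi.smul_apply, smul_eq_mul]
  rw [polyFun_apply (normSq m * _), map_mul, ← polyFun_apply, ← polyFun_apply, polyFun_normSq]
  ring

lemma D₂_toFunDist (k : ℕ) (T : PolyDist m) :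
    D₂ k distPartialX (toFunDist T) =
      toFunDist (opD₂ opA opU opρ opL (para m + k) T) := by
  rw [D₂, laplacianX_toFunDist, DuDx_toFunDist, twistor_toFunDist]
  funext φ u
  have : 4 / ((m : ℂ) + 2 * k - 2) = 2 / (para m + k + 1) := by
    have h : (m : ℂ) + 2 * k - 2 = 2 * (para m + k + 1) := by simp only [para]; ring
    rw [h, show (4 : ℂ) = 2 * 2 by norm_num, mul_div_mul_left _ _ two_ne_zero]
  simp [opD₂, toFunDist, this]

lemma D₄_toFunDist (k : ℕ) (T : PolyDist m) :
    D₄ k distPartialX (toFunDist T) = toFunDist (opD₄ k T) := by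
  rw [D₄, laplacianX_toFunDist, D₂_toFunDist, D₂_toFunDist, D₂_toFunDist]
  funext φ u
  have : 8 / (((m : ℂ) + 2 * k - 2) * ((m : ℂ) + 2 * k - 4)) =
      2 / ((para m + k) * (para m + k + 1)) := by
    have h : ((m : ℂ) + 2 * k - 2) * ((m : ℂ) + 2 * k - 4) =
        4 * ((para m + k) * (para m + k + 1)) := by simp only [para]; ring
    rw [h, show (8 : ℂ) = 4 * 2 by norm_num, mul_div_mul_left _ _ (by norm_num : (4 : ℂ) ≠ 0)]
  simp [opD₄, toFunDist, this]

end Transfer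

/-! ### Pointwise evaluation, and the fundamental solution itself. -/

section Evaluation

variable {m : ℕ}

/-- Evaluation of polynomials in `x` and `u`. -/
def eval₂ (x u : X m) : Poly₂ m →ₐ[ℂ] ℂ :=
  aeval (Sum.elim (fun i => ((x i : ℝ) : ℂ)) fun i => ((u i : ℝ) : ℂ))

/-- Substitution of `u + t x` for `u`. -/
def shift (x u : X m) : Poly₂ m →ₐ[ℂ] Polynomial ℂ :=
  aeval (Sum.elim (fun i => Polynomial.C ((x i : ℝ) : ℂ))
    fun i => Polynomial.C ((u i : ℝ) : ℂ) + Polynomial.X * Polynomial.C ((x i : ℝ) : ℂ))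

lemma xDu_mul (P Q : Poly₂ m) : xDu m (P * Q) = xDu m P * Q + P * xDu m Q := by
  simp only [xDu_apply, pderiv_mul, mul_add, Finset.sum_add_distrib, Finset.mul_sum,
    Finset.sum_mul]
  exact congrArg₂ (· + ·) (Finset.sum_congr rfl fun _ _ => by ring)
    (Finset.sum_congr rfl fun _ _ => by ring)

lemma xDu_X_inl (i : Fin m) : xDu m (MvPolynomial.X (Sum.inl i)) = 0 := by
  simp [xDu_apply]

lemma xDu_X_inr (i : Fin m) :
    xDu m (MvPolynomial.X (Sum.inr i)) = MvPolynomial.X (Sum.inl i) := by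
  classical
  simp [xDu_apply, pderiv_X, Pi.single_apply]

/-- Along u + t x the t-derivative is ⟨x,D_u⟩, since both are derivations agreeing on the variables.
This identifies `taylor` with the coefficients in t. -/
lemma derivative_shift (x u : X m) (Q : Poly₂ m) :
    Polynomial.derivative (shift x u Q) = shift x u (xDu m Q) := by
  induction Q using MvPolynomial.induction_on with
  | C a => simp [shift, xDu_apply]
  | add p q hp hq => simp only [map_add, hp, hq]
  | mul_X p j hp =>
    have hj : Polynomial.derivative (shift x u (MvPolynomial.X j)) =
        shift x u (xDu m (MvPolynomial.X j)) := by
      rcases j with i | i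
      · rw [xDu_X_inl]; simp [shift]
      · rw [xDu_X_inr]; simp [shift]
    rw [map_mul, Polynomial.derivative_mul, hp, xDu_mul, map_add, map_mul, map_mul, hj]

lemma eval_zero_shift (x u : X m) (Q : Poly₂ m) : (shift x u Q).eval 0 = eval₂ x u Q := by
  have h : (Polynomial.aeval (0 : ℂ)).comp (shift x u) = eval₂ x u := by
    refine MvPolynomial.algHom_ext fun j => ?_
    rcases j with i | i <;> simp [shift, eval₂]
  rw [← h]
  simp

lemma eval_shift_rename (x u : X m) (t : ℝ) (p : MvPolynomial (Fin m) ℂ) :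
    (shift x u (rename Sum.inr p)).eval (t : ℂ) = polyFun m p (u + t • x) := by
  have h : ((Polynomial.aeval (t : ℂ)).comp (shift x u)).comp (rename Sum.inr) =
      aeval (fun i => (((u + t • x) i : ℝ) : ℂ)) := by
    refine MvPolynomial.algHom_ext fun i => ?_
    simp [shift]
    ring
  rw [polyFun_apply, ← h]
  simp

lemma iterate_derivative_shift (x u : X m) (p : MvPolynomial (Fin m) ℂ) (j : ℕ) :
    Polynomial.derivative^[j] (shift x u (rename Sum.inr p)) =
      (j.factorial : ℂ) • shift x u (taylor p j) := by
  induction j with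
  | zero => simp [taylor]
  | succ j ih =>
    rw [Function.iterate_succ_apply', ih, Polynomial.derivative_smul, derivative_shift,
      xDu_taylor, map_smul, smul_smul, Nat.factorial_succ]
    push_cast
    ring_nf

lemma coeff_shift (x u : X m) (p : MvPolynomial (Fin m) ℂ) (j : ℕ) :
    (shift x u (rename Sum.inr p)).coeff j = eval₂ x u (taylor p j) := by
  have h := congrArg (fun q => Polynomial.coeff q 0) (iterate_derivative_shift x u p j)
  simp only [Polynomial.coeff_iterate_derivative, zero_add, Nat.descFactorial_self,
    Polynomial.coeff_smul, nsmul_eq_mul, smul_eq_mul] at h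
  rw [mul_left_cancel₀ (by exact_mod_cast j.factorial_ne_zero) h, Polynomial.coeff_zero_eq_eval_zero,
    eval_zero_shift]

/-- Taylor's formula for homogeneous polynomials. -/
theorem polyFun_add_smul {p : MvPolynomial (Fin m) ℂ} {k : ℕ} (hp : euler m p = (k : ℂ) • p)
    (x u : X m) (t : ℝ) :
    polyFun m p (u + t • x) = ∑ j ∈ Finset.range (k + 1), (t : ℂ) ^ j * eval₂ x u (taylor p j) := by
  have hd : (shift x u (rename Sum.inr p)).natDegree < k + 1 := by
    refine Nat.lt_succ_of_le (Polynomial.natDegree_le_iff_coeff_eq_zero.2 fun j hj => ?_)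
    rw [coeff_shift, taylor_eq_zero hp hj, map_zero]
  rw [← eval_shift_rename, Polynomial.eval_eq_sum_range' hd]
  exact Finset.sum_congr rfl fun j _ => by rw [coeff_shift, mul_comm]

lemma eval₂_pairing (x u : X m) : eval₂ x u (pairing m) = ((inner ℝ x u : ℝ) : ℂ) := by
  simp [pairing, eval₂, PiLp.inner_apply, mul_comm]

lemma polyFun_sandwich {p : MvPolynomial (Fin m) ℂ} {k : ℕ} (hp : euler m p = (k : ℂ) • p)
    (x u : X m) :
    polyFun m p (sandwich x u) = ∑ i ∈ Finset.range (k + 1),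
      (-2 : ℂ) ^ i * ((((‖x‖ ^ 2)⁻¹ ^ i : ℝ) : ℂ) * eval₂ x u (pairing m ^ i * taylor p i)) := by
  have h : sandwich x u = u + (-2 * (‖x‖ ^ 2)⁻¹ * inner ℝ x u) • x := by
    rw [sandwich, sub_eq_add_neg, ← neg_smul]
    congr 2
    ring
  rw [h, polyFun_add_smul hp]
  refine Finset.sum_congr rfl fun i _ => ?_
  rw [map_mul, map_pow, eval₂_pairing]
  push_cast
  ring

lemma polyFun_monomial (α : Fin m →₀ ℕ) (c : ℂ) (u : X m) :
    polyFun m (monomial α c) u = c * (monoFun α u : ℝ) := by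
  rw [polyFun_apply, aeval_monomial, Finsupp.prod_fintype _ _ (by simp)]
  simp [monoFun]

lemma eval₂_monomial (γ : Fin m ⊕ Fin m →₀ ℕ) (c : ℂ) (x u : X m) :
    eval₂ x u (monomial γ c) = c * ((monoFun (xPart γ) x : ℝ) * (monoFun (uPart γ) u : ℝ)) := by
  rw [eval₂, aeval_monomial, Finsupp.prod_fintype _ _ (by simp), Fintype.prod_sum_type]
  simp [monoFun, xPart, uPart]

/-- Integrability is carried along with the formula because the additive step of the induction needs
it. -/
lemma polyFun_powerDist (hm : 1 ≤ m) {a : ℝ} {d : ℕ} {Q : Poly₂ m}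
    (hQ : IsWeightedHomogeneous wx Q d) (had : -(m : ℝ) < a + d) (φ : Test m) (u : X m) :
    Integrable (fun x => ((φ x : ℝ) : ℂ) * (((‖x‖ ^ a : ℝ) : ℂ) * eval₂ x u Q)) ∧
      polyFun m (powerDist a Q φ) u =
        ∫ x, ((φ x : ℝ) : ℂ) * (((‖x‖ ^ a : ℝ) : ℂ) * eval₂ x u Q) := by
  induction hQ using IsWeightedHomogeneous.induction_on with
  | zero => simp
  | add p q _ _ hp hq =>
    simp only [map_add, mul_add, Pi.add_apply]
    exact ⟨hp.1.add hq.1, by rw [hp.2, hq.2, integral_add hp.1 hq.1]⟩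
  | monomial γ c hγ =>
    rw [weight_wx] at hγ
    have hi := integrable_monoFun hm (xPart γ) (a := a) (by rwa [hγ]) φ
    have e1 : (fun x => ((φ x : ℝ) : ℂ) * (((‖x‖ ^ a : ℝ) : ℂ) * eval₂ x u (monomial γ c))) =
        fun x => (c * (monoFun (uPart γ) u : ℝ)) *
          ((φ x * (‖x‖ ^ a * monoFun (xPart γ) x) : ℝ) : ℂ) := by
      funext x
      rw [eval₂_monomial]
      push_cast
      ring
    rw [e1]
    refine ⟨hi.ofReal.const_mul _, ?_⟩
    rw [integral_const_mul, integral_complex_ofReal, powerDist_monomial, polyFun_monomial]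
    ring

lemma regularDist_sandwich (hm : 1 ≤ m) {p : MvPolynomial (Fin m) ℂ} {k : ℕ}
    (hp : euler m p = (k : ℂ) • p) (c : ℝ) :
    regularDist (fun x u => ((c * ‖x‖ ^ (4 - (m : ℤ)) : ℝ) : ℂ) * polyFun m p (sandwich x u)) =
      toFunDist ((c : ℂ) • reflectionDist p 0 k) := by
  have : Nonempty (Fin m) := ⟨⟨0, hm⟩⟩
  funext φ u
  have h : ∀ i, _ := fun i : ℕ => polyFun_powerDist hm (a := expo m - 2 * i)
    (isWeightedHomogeneous_pairing_pow_mul (isWeightedHomogeneous_taylor p i) i)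
    (by simp only [expo]; push_cast; linarith) φ u
  have e1 : toFunDist ((c : ℂ) • reflectionDist p 0 k) φ u =
      (c : ℂ) * ∑ i ∈ Finset.range (k + 1), (-2 : ℂ) ^ i *
        polyFun m (powerDist (expo m - 2 * i) (pairing m ^ i * taylor p i) φ) u := by
    simp [toFunDist, reflectionDist]
  rw [e1]
  simp only [(h _).2, ← integral_const_mul]
  rw [← integral_finsetSum _ fun i _ => (h i).1.const_mul _, ← integral_const_mul, regularDist]
  refine integral_congr_ae ?_
  filter_upwards [Measure.ae_ne volume (0 : X m)] with x hx
  have hn : 0 < ‖x‖ := norm_pos_iff.2 hx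
  have hz : ‖x‖ ^ (4 - (m : ℤ)) = ‖x‖ ^ expo m := by
    rw [← Real.rpow_intCast]; push_cast; rfl
  rw [polyFun_sandwich hp, hz, Finset.mul_sum, Finset.mul_sum, Finset.mul_sum]
  refine Finset.sum_congr rfl fun i _ => ?_
  have h2 : ‖x‖ ^ (expo m - 2 * i) = ‖x‖ ^ expo m * (‖x‖ ^ 2)⁻¹ ^ i := by
    rw [Real.rpow_sub hn, Real.rpow_mul hn.le, Real.rpow_natCast, Real.rpow_two, inv_pow]
    rfl
  rw [h2]
  push_cast
  ring

lemma isHarmonicOfDegree_of_mem {p : MvPolynomial (Fin m) ℂ} {k : ℕ}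
    (hp : p ∈ MvPolynomial.homogeneousSubmodule (Fin m) ℂ k ⊓ LinearMap.ker (polyLaplacian m)) :
    IsHarmonicOfDegree k p := by
  refine ⟨hp.2, ?_⟩
  have h := IsHomogeneous.sum_X_mul_pderiv hp.1
  rw [euler_apply, h, Nat.cast_smul_eq_nsmul]

lemma IsHarmonicOfDegree.mem {p : MvPolynomial (Fin m) ℂ} {k : ℕ}
    (hp : IsHarmonicOfDegree k p) :
    p ∈ MvPolynomial.homogeneousSubmodule (Fin m) ℂ k ⊓ LinearMap.ker (polyLaplacian m) := by
  refine ⟨?_, hp.1⟩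
  intro d hd
  have h := coeff_euler p d
  rw [hp.2, coeff_smul, smul_eq_mul] at h
  have h2 := mul_right_cancel₀ hd h
  have h3 : d.degree = k := by exact_mod_cast h2.symm
  rw [← h3, Finsupp.degree_eq_weight_one]
  rfl

lemma polyFun_comp_sandwich_mem {p : MvPolynomial (Fin m) ℂ} {k : ℕ}
    (hp : IsHarmonicOfDegree k p) {x : X m} (hx : x ≠ 0) :
    (fun u => polyFun m p (sandwich x u)) ∈ Hk m k := by
  set S : Poly₂ m →ₐ[ℂ] MvPolynomial (Fin m) ℂ :=
    aeval (Sum.elim (fun i => C ((x i : ℝ) : ℂ)) MvPolynomial.X) with hS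
  have hn : ((‖x‖ : ℝ) : ℂ) ≠ 0 := by exact_mod_cast norm_ne_zero_iff.2 hx
  have hSr : S (xNormSq m) = C (((‖x‖ : ℝ) : ℂ) ^ 2) := by
    rw [← Complex.ofReal_pow, EuclideanSpace.real_norm_sq_eq]
    simp [xNormSq, hS, pow_two]
  have hSD : ∀ i Q, S (pderiv (Sum.inr i) Q) = pderiv i (S Q) := by
    intro i Q
    classical
    induction Q using MvPolynomial.induction_on with
    | C a => simp [hS]
    | add p q hp hq => simp only [map_add, hp, hq]
    | mul_X p j hp =>
      have hj : S (pderiv (Sum.inr i) (MvPolynomial.X j)) = pderiv i (S (MvPolynomial.X j)) := by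
        rcases j with j | j
        · rw [pderiv_inr_X_inl]; simp [hS]
        · simp [hS, pderiv_X, Pi.single_apply, apply_ite]
      rw [pderiv_mul, map_add, map_mul, map_mul, hp, map_mul, pderiv_mul, hj]
  -- The same harmonicity argument, now with the functionals "substitute the fixed x and divide by
  -- ‖x‖^{2n}".
  have h := isHarmonicOfDegree_reflection hp
    (fun n => ((((‖x‖ : ℝ) : ℂ) ^ 2)⁻¹ ^ n) • S.toLinearMap)
    (fun n i Q => by simp [hS]) (fun n i Q => by simp [hSD])
    (fun i => by
      simp only [LinearMap.smul_apply, AlgHom.toLinearMap_apply]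
      rw [map_mul, hSr, ← smul_eq_C_mul, smul_smul]
      congr 1
      rw [pow_succ _ (i + 1), mul_assoc, inv_mul_cancel₀ (pow_ne_zero 2 hn), mul_one])
  refine ⟨_, h.mem, ?_⟩
  funext u
  have hc : ∀ Q, polyFun m (S Q) u = eval₂ x u Q := by
    intro Q
    have : (aeval (fun i => ((u i : ℝ) : ℂ))).comp S = eval₂ x u := by
      refine MvPolynomial.algHom_ext fun j => ?_
      rcases j with i | i <;> simp [hS, eval₂]
    rw [← this]
    rfl
  rw [polyFun_sandwich hp.2, map_sum, Finset.sum_apply]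
  refine Finset.sum_congr rfl fun i _ => ?_
  rw [LinearMap.smul_apply, AlgHom.toLinearMap_apply, map_smul, map_smul, Pi.smul_apply,
    Pi.smul_apply, hc, smul_eq_mul, smul_eq_mul]
  push_cast
  rfl

/-- A crude bound by the triangle inequality, valid also at x = 0; only boundedness in x is needed
for local integrability. -/
lemma norm_sandwich_le (x u : X m) : ‖sandwich x u‖ ≤ 3 * ‖u‖ := by
  rcases eq_or_ne x 0 with rfl | hx
  · simp [sandwich]
    linarith [norm_nonneg u]
  have hn : 0 < ‖x‖ := norm_pos_iff.2 hx
  have h1 : ‖(2 * inner ℝ x u / ‖x‖ ^ 2) • x‖ ≤ 2 * ‖u‖ := by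
    rw [norm_smul, norm_div, norm_mul, norm_pow, norm_norm, Real.norm_two, div_mul_eq_mul_div,
      div_le_iff₀ (by positivity)]
    have := norm_inner_le_norm (𝕜 := ℝ) x u
    nlinarith [mul_le_mul_of_nonneg_right this hn.le]
  calc _ ≤ ‖u‖ + ‖(2 * inner ℝ x u / ‖x‖ ^ 2) • x‖ := norm_sub_le _ _
    _ ≤ _ := by linarith

lemma continuous_polyFun (p : MvPolynomial (Fin m) ℂ) : Continuous (polyFun m p) :=
  (contDiff_aeval (𝕜 := ℂ) p).continuous

lemma locallyIntegrable_sandwich (hm : 1 ≤ m) (p : MvPolynomial (Fin m) ℂ) (c : ℝ) (u : X m) :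
    LocallyIntegrable fun x : X m =>
      ((c * ‖x‖ ^ (4 - (m : ℤ)) : ℝ) : ℂ) * polyFun m p (sandwich x u) := by
  have : Nonempty (Fin m) := ⟨⟨0, hm⟩⟩
  obtain ⟨B, hB⟩ := (isCompact_closedBall (0 : X m) (3 * ‖u‖)).exists_bound_of_continuousOn
    (continuous_polyFun p).continuousOn
  refine locallyIntegrable_of_norm_le_rpow (C := |c| * B) (α := m - 4) (by simpa using hm)
    (by simp) ?_ ?_
  · filter_upwards with x
    have hz : ‖x‖ ^ (4 - (m : ℤ)) = ‖x‖ ^ (-((m : ℝ) - 4)) := by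
      rw [← Real.rpow_intCast]; push_cast; ring_nf
    have h := hB (sandwich x u) (by simpa using norm_sandwich_le x u)
    rw [norm_mul, Complex.norm_real, norm_mul, hz, Real.norm_eq_abs, Real.norm_eq_abs,
      abs_of_nonneg (Real.rpow_nonneg (norm_nonneg x) _)]
    calc _ ≤ |c| * ‖x‖ ^ (-((m : ℝ) - 4)) * B := by gcongr
      _ = _ := by ring
  · have hs : Measurable fun x : X m => sandwich x u := by
      unfold sandwich
      fun_prop
    exact (Measurable.mul (by fun_prop)
      ((continuous_polyFun p).measurable.comp hs)).aestronglyMeasurable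

/-- There are nonzero harmonic polynomials of every degree. -/
lemma exists_mem_Hk_ne_zero (hm : 2 ≤ m) (k : ℕ) : ∃ f ∈ Hk m k, ∃ v, f v ≠ 0 := by
  classical
  set a : Fin m := ⟨0, by omega⟩
  set b : Fin m := ⟨1, by omega⟩
  have hab : a ≠ b := by simp [a, b]
  -- x_a + i x_b has isotropic gradient, 1 + i² = 0, so all its powers are harmonic.
  set z : MvPolynomial (Fin m) ℂ := MvPolynomial.X a + C Complex.I * MvPolynomial.X b with hz
  have hd : ∀ i, pderiv i z = C ((if i = a then 1 else 0) + if i = b then Complex.I else 0) := by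
    intro i
    have hX : ∀ j, pderiv i (MvPolynomial.X j : MvPolynomial (Fin m) ℂ) =
        C (if i = j then 1 else 0) := by
      intro j
      rcases eq_or_ne i j with rfl | h
      · simp
      · simp [pderiv_X_of_ne h.symm, h]
    rw [hz, map_add, pderiv_mul, pderiv_C, hX, hX, zero_mul, zero_add, ← C_mul, ← C_add, mul_ite,
      mul_one, mul_zero]
  refine ⟨polyFun m (z ^ k), ⟨z ^ k, ⟨?_, ?_⟩, rfl⟩, e a, ?_⟩
  · have h1 : z.IsHomogeneous 1 := (isHomogeneous_X ℂ a).add (by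
      simpa using (isHomogeneous_C (Fin m) Complex.I).mul (isHomogeneous_X ℂ b))
    simpa using h1.pow k
  · have hsum : ∑ i, pderiv i z * pderiv i z = 0 := by
      simp only [hd, ← C_mul, ← map_sum]
      convert C_0 (R := ℂ)
      have : ∀ i : Fin m, ((if i = a then (1 : ℂ) else 0) + if i = b then Complex.I else 0) *
          ((if i = a then 1 else 0) + if i = b then Complex.I else 0) =
          (if i = a then 1 else 0) + if i = b then -1 else 0 := by
        intro i
        split_ifs with h1 h2 h2
        · exact absurd (h1.symm.trans h2) hab
        all_goals simp
      simp [this, Finset.sum_add_distrib]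
    have hdd : ∀ i, pderiv i (pderiv i z) = 0 := fun i => by rw [hd, pderiv_C]
    refine LinearMap.mem_ker.2 ?_
    rw [polyLaplacian_apply]
    have h2 : ∀ i, pderiv i (pderiv i (z ^ k)) =
        (k * (k - 1 : ℕ) * z ^ (k - 1 - 1)) * (pderiv i z * pderiv i z) := by
      intro i
      rw [pderiv_pow, pderiv_mul, hdd, mul_zero, add_zero, pderiv_mul, pderiv_pow]
      simp
      ring
    simp only [h2]
    rw [← Finset.mul_sum, hsum, mul_zero]
  · rw [polyFun_apply]
    simp [hz, hab.symm]

/-- If the kernel vanished, the reproducing property would kill every f in H_k. Without this the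
equation D₄E = δ Z_k would not determine c. -/
lemma exists_reproducingKernel_ne_zero (hm : 2 ≤ m) (k : ℕ) :
    ∃ u v, reproducingKernel m k u v ≠ 0 := by
  obtain ⟨f, hf, v, hv⟩ := exists_mem_Hk_ne_zero hm k
  by_contra! h
  apply hv
  rw [← (reproducingKernel_spec (by omega) k).2 f hf v]
  simp [sphereInner, h]

lemma exists_test_apply_zero : ∃ φ : Test m, φ 0 = 1 := by
  let f : ContDiffBump (0 : X m) := ⟨1, 2, one_pos, one_lt_two⟩
  exact ⟨⟨f, f.contDiff, f.hasCompactSupport, Set.subset_univ _⟩, 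
    f.one_of_mem_closedBall (by simp [f.rIn_pos.le])⟩

theorem isFundamentalSolution_iff (hm : 3 ≤ m) (hm4 : m ≠ 4) (k : ℕ) (c : ℝ) :
    IsFundamentalSolution m k (fun x u v =>
        ((c * ‖x‖ ^ (4 - (m : ℤ)) : ℝ) : ℂ) * reproducingKernel m k (sandwich x u) v) ↔
      c * fundamentalConst m k = 1 := by
  have hZ := fun v => (reproducingKernel_spec (by omega : 0 < m) k).1 v
  choose P hP hPZ using hZ
  have hP' := fun v => isHarmonicOfDegree_of_mem (hP v)
  have hPZ' : ∀ u v, reproducingKernel m k u v = polyFun m (P v) u := fun u v =>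
    (congrFun (hPZ v) u).symm
  -- For every c the candidate satisfies the equation up to the scalar c · `fundamentalConst m k`;
  -- both directions of the equivalence read off from this.
  have key : ∀ v φ u, D₄ k distPartialX (regularDist fun x u =>
        ((c * ‖x‖ ^ (4 - (m : ℤ)) : ℝ) : ℂ) * reproducingKernel m k (sandwich x u) v) φ u =
      ((c * fundamentalConst m k : ℝ) : ℂ) *
        (((φ 0 : ℝ) : ℂ) * reproducingKernel m k u v) := by
    intro v φ u
    simp only [hPZ']
    rw [regularDist_sandwich (by omega) (hP' v).2, D₄_toFunDist]
    have h1 : opD₄ k ((c : ℂ) • reflectionDist (P v) 0 k) =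
        (c : ℂ) • opD₄ k (reflectionDist (P v) 0 k) := by
      simp only [opD₄, map_smul]
      module
    rw [h1, toFunDist, Pi.smul_apply, opD₄_reflectionDist hm hm4 (hP' v), map_smul, map_smul,
      Pi.smul_apply, Pi.smul_apply, smul_eq_mul, smul_eq_mul]
    push_cast
    ring
  constructor
  · rintro ⟨-, -, h⟩
    obtain ⟨u, v, huv⟩ := exists_reproducingKernel_ne_zero (by omega : 2 ≤ m) k
    obtain ⟨φ, hφ⟩ := exists_test_apply_zero (m := m)
    have h2 := (key v φ u).symm.trans (h v φ u)
    rw [hφ, Complex.ofReal_one, one_mul] at h2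
    have h3 : ((c * fundamentalConst m k : ℝ) : ℂ) = 1 := by
      simpa [huv] using h2
    exact_mod_cast h3
  · intro hc
    refine ⟨fun x hx v => ?_, fun u v => ?_, fun v φ u => ?_⟩
    · have h := (Hk m k).smul_mem ((c * ‖x‖ ^ (4 - (m : ℤ)) : ℝ) : ℂ)
        (polyFun_comp_sandwich_mem (hP' v) hx)
      simp only [hPZ']
      exact h
    · simp only [hPZ']
      exact locallyIntegrable_sandwich (by omega) (P v) c u
    · rw [key, hc, Complex.ofReal_one, one_mul]

end Evaluation

end HigherSpin

end

theorem mainTheorem7 (m k : ℕ) (hm : 3 ≤ m) (hm4 : m ≠ 4) (hm6 : m ≠ 6) :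
    ∃ c₂ : ℝ, c₂ ≠ 0 ∧ ∀ c : ℝ,
      HigherSpin.IsFundamentalSolution m k (fun x u v =>
        ((c * ‖x‖ ^ (4 - (m : ℤ)) : ℝ) : ℂ) *
          HigherSpin.reproducingKernel m k (HigherSpin.sandwich x u) v) ↔ c = c₂ := by
  have h := HigherSpin.fundamentalConst_ne_zero hm hm4 hm6 k
  refine ⟨(HigherSpin.fundamentalConst m k)⁻¹, inv_ne_zero h, fun c => ?_⟩
  rw [HigherSpin.isFundamentalSolution_iff hm hm4, mul_eq_one_iff_eq_inv₀ h]
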